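/- Let $G$ be a countable discrete amenable group, let $X$ be a compact metrizable space, and let $\alpha: G\curvearrowright X$ be a free action by homeomorphisms. Write $u_g$ ($g\in G$) for the canonical unitaries of the crossed product $C(X)\rtimes_\alpha G$, so that $u_g f u_g^* = f\circ\alpha_g^{-1}$ for $f\in C(X)$. For a $C^*$-algebra $A$ and a $C^*$-subalgebra $D\subseteq A$ let $\mathcal N_A(D)=\{a\in A: a^*Da\subseteq D,\ aDa^*\subseteq D\}$ be the set of normalizers of $D$ in $A$. Let $M_n$ be the algebra of complex $n\times n$ matrices, with matrix units $e_{ij}$, and let $D_n\subseteq M_n$ be the subalgebra of diagonal matrices. A completely positive contractive (c.p.c.) map $\phi$ between $C^*$-algebras is order zero if $\phi(a)\phi(b)=0$ whenever $a,b$ are positive and $ab=0$. Let $\phi:M_n\to C(X)\rtimes_\alpha G$ be a c.p.c. order zero map such that $\phi(\mathcal N_{M_n}(D_n))\subseteq \mathcal N_{C(X)\rtimes_\alpha G}(C(X))$. Then $\phi$ is a castle order zero map, that is, there are a countable set $T$ and, for each $t\in T$, a function $f_t\in C(X)_+$ with open support $\mathrm{supp}^\circ(f_t)=\{x\in X: f_t(x)\neq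 0\}$, a subset $S_t=\{s_{t,1},\dots,s_{t,n}\}$ of $G$ of size $n$, and continuous functions $\theta_{t,1},\dots,\theta_{t,n}:\mathrm{supp}^\circ(f_t)\to\mathbb T$, such that 1. $\lim_{t\to\infty}\|f_t\|=0$, that is, $\{t\in T:\|f_t\|\ge\varepsilon\}$ is finite for every $\varepsilon>0$; 2. $(\mathrm{supp}^\circ(f_t),S_t)_{t\in T}$ is a castle, that is, the sets $s\,\mathrm{supp}^\circ(f_t)$ ($t\in T$, $s\in S_t$) are pairwise disjoint; 3. for all $i,j\in\{1,\dots,n\}$, $$\phi(e_{ij})=\sum_{t\in T}u_{s_{t,i}}\,\theta_{t,i}\,\bar\theta_{t,j}\,f_t\,u_{s_{t,j}}^*,$$ where $\theta_{t,i}\bar\theta_{t,j}f_t$ is extended by $0$ off $\mathrm{supp}^\circ(f_t)$ and the sum converges (unconditionally) in norm. -/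

import Mathlib

open Filter Topology
open scoped ENNReal CStarAlgebra Pointwise ComplexOrder

universe u v

noncomputable section

/-! ### Amenability -/

/-- A discrete group is amenable if it satisfies Følner's condition: for every finite `K ⊆ G` and
every `ε > 0` there is a nonempty finite `F ⊆ G` with `|gF ∆ F| ≤ ε |F|` for all `g ∈ K`. -/
def IsAmenableGroup (G : Type u) [Group G] : Prop :=
  ∀ (K : Set G), K.Finite → ∀ ε : ℝ, 0 < ε →
    ∃ F : Set G, F.Finite ∧ F.Nonempty ∧
      ∀ g ∈ K, ((symmDiff (g • F) F).ncard : ℝ) ≤ ε * (F.ncard : ℝ)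

/-! ### The crossed product of `C(X)` by `G` -/

/-- The function `f ∘ α_g⁻¹`, i.e. `x ↦ f (g⁻¹ x)`. -/
def translateFun {G : Type u} {X : Type v} [Group G] [TopologicalSpace X] [MulAction G X]
    [ContinuousConstSMul G X] (g : G) (f : C(X, ℂ)) : C(X, ℂ) :=
  f.comp ⟨fun x => g⁻¹ • x, continuous_const_smul g⁻¹⟩

/-- A covariant representation `(π, U)` of the dynamical system `G ↷ X` on a nonzero complex
Hilbert space `H`: a unital `*`-representation `π` of `C(X)` and a unitary representation `U` of
`G` with `U_g π(f) U_g^* = π(f ∘ α_g⁻¹)`. (Every cyclic covariant representation is unitarily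
equivalent to one on a Hilbert space in the universe used here.) -/
structure CovariantRep (G : Type u) (X : Type v) [Group G] [TopologicalSpace X]
    [CompactSpace X] [MulAction G X] [ContinuousConstSMul G X] where
  /-- the Hilbert space -/
  H : Type (max u v)
  [normedAddCommGroup : NormedAddCommGroup H]
  [innerProductSpace : InnerProductSpace ℂ H]
  [completeSpace : CompleteSpace H]
  [nontrivial : Nontrivial H]
  /-- the representation of `C(X)` -/
  π : C(X, ℂ) →⋆ₐ[ℂ] (H →L[ℂ] H)
  /-- the representation of `G` -/
  U : G →* unitary (H →L[ℂ] H)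
  covariant : ∀ (g : G) (f : C(X, ℂ)),
    (U g : H →L[ℂ] H) * π f * star (U g : H →L[ℂ] H) = π (translateFun g f)

attribute [instance] CovariantRep.normedAddCommGroup CovariantRep.innerProductSpace
  CovariantRep.completeSpace CovariantRep.nontrivial

section CrossedProduct

variable (G : Type u) (X : Type v) [Group G] [TopologicalSpace X] [CompactSpace X]
  [MulAction G X] [ContinuousConstSMul G X]

/-- The C⋆-algebra of bounded families `(a_ρ)`, with `a_ρ` a bounded operator on the space of the
covariant representation `ρ`, under the supremum norm. -/
abbrev CovariantFamilies : Type (max u v + 1) :=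
  lp (fun ρ : CovariantRep.{u, v} G X => (ρ.H →L[ℂ] ρ.H)) ∞

instance CovariantFamilies.instCStarAlgebra : CStarAlgebra (CovariantFamilies G X) where

variable {X} in
theorem CovariantFamilies.memℓp_fun (f : C(X, ℂ)) :
    Memℓp (fun ρ : CovariantRep.{u, v} G X => ρ.π f) ∞ := by
  refine memℓp_infty ⟨‖f‖, ?_⟩
  rintro _ ⟨ρ, rfl⟩
  exact NonUnitalStarAlgHom.norm_apply_le ρ.π f

variable {G} in
theorem CovariantFamilies.memℓp_unitary (g : G) :
    Memℓp (fun ρ : CovariantRep.{u, v} G X => (ρ.U g : ρ.H →L[ℂ] ρ.H)) ∞ := by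
  refine memℓp_infty ⟨1, ?_⟩
  rintro _ ⟨ρ, rfl⟩
  exact (CStarRing.norm_coe_unitary (ρ.U g)).le

/-- The direct sum over all covariant representations of the representations of `C(X)`. -/
def CovariantFamilies.ofFun : C(X, ℂ) →⋆ₐ[ℂ] CovariantFamilies G X where
  toFun f := ⟨fun ρ => ρ.π f, CovariantFamilies.memℓp_fun G f⟩
  map_one' := by ext ρ : 2; exact map_one ρ.π
  map_mul' f g := by ext ρ : 2; exact map_mul ρ.π f g
  map_zero' := by ext ρ : 2; exact map_zero ρ.π
  map_add' f g := by ext ρ : 2; exact map_add ρ.π f g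
  commutes' c := by ext ρ : 2; exact AlgHomClass.commutes ρ.π c
  map_star' f := by ext ρ : 2; exact map_star ρ.π f

/-- The direct sum over all covariant representations of the representations of `G`. -/
def CovariantFamilies.ofGroup : G →* unitary (CovariantFamilies G X) where
  toFun g := ⟨⟨fun ρ => (ρ.U g : ρ.H →L[ℂ] ρ.H), CovariantFamilies.memℓp_unitary X g⟩, by
    rw [Unitary.mem_iff]
    constructor
    · ext ρ : 2; exact Unitary.coe_star_mul_self (ρ.U g)
    · ext ρ : 2; exact Unitary.coe_mul_star_self (ρ.U g)⟩
  map_one' := by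
    ext ρ : 3
    exact congrArg Subtype.val (map_one ρ.U)
  map_mul' g h := by
    ext ρ : 3
    exact congrArg Subtype.val (map_mul ρ.U g h)

/-- The C⋆-algebra generated by the images of `C(X)` and `G` in the direct sum of all covariant
representations. -/
def crossedProductSubalgebra : StarSubalgebra ℂ (CovariantFamilies G X) :=
  (StarAlgebra.adjoin ℂ (Set.range (CovariantFamilies.ofFun G X) ∪
    Set.range (fun g : G => (CovariantFamilies.ofGroup G X g : CovariantFamilies G X)))
    ).topologicalClosure

instance crossedProductSubalgebra.instIsClosed :
    IsClosed (crossedProductSubalgebra G X : Set (CovariantFamilies G X)) :=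
  StarSubalgebra.isClosed_topologicalClosure _

/-- The (full) crossed product C⋆-algebra `C(X) ⋊ G`: the completion of the linear span of the
`f u_g` in the norm `‖a‖ = sup ‖(π ⋊ U)(a)‖`, the supremum over all covariant representations. -/
def CrossedProduct : Type (max u v + 1) := crossedProductSubalgebra G X

instance CrossedProduct.instCStarAlgebra : CStarAlgebra (CrossedProduct G X) :=
  inferInstanceAs (CStarAlgebra (crossedProductSubalgebra G X))

/-- The order of a C⋆-algebra: `a ≤ b` iff `b - a` is positive. -/
instance CrossedProduct.instPartialOrder : PartialOrder (CrossedProduct G X) :=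
  CStarAlgebra.spectralOrder _

instance CrossedProduct.instStarOrderedRing : StarOrderedRing (CrossedProduct G X) :=
  CStarAlgebra.spectralOrderedRing _

theorem crossedProductSubalgebra.ofFun_mem (f : C(X, ℂ)) :
    CovariantFamilies.ofFun G X f ∈ crossedProductSubalgebra G X :=
  StarSubalgebra.le_topologicalClosure _ (StarAlgebra.subset_adjoin ℂ _ (Or.inl ⟨f, rfl⟩))

theorem crossedProductSubalgebra.ofGroup_mem (g : G) :
    (CovariantFamilies.ofGroup G X g : CovariantFamilies G X) ∈ crossedProductSubalgebra G X :=
  StarSubalgebra.le_topologicalClosure _ (StarAlgebra.subset_adjoin ℂ _ (Or.inr ⟨g, rfl⟩))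

/-- The canonical inclusion of `C(X)` in `C(X) ⋊ G`. -/
def CrossedProduct.ofFun : C(X, ℂ) →⋆ₐ[ℂ] CrossedProduct G X :=
  (CovariantFamilies.ofFun G X).codRestrict (crossedProductSubalgebra G X)
    (crossedProductSubalgebra.ofFun_mem G X)

/-- The canonical unitaries `u_g` of `C(X) ⋊ G`. -/
def CrossedProduct.u (g : G) : CrossedProduct G X :=
  ⟨(CovariantFamilies.ofGroup G X g : CovariantFamilies G X),
    crossedProductSubalgebra.ofGroup_mem G X g⟩

/-- The subalgebra `C(X)` of `C(X) ⋊ G`. -/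
def CrossedProduct.base : StarSubalgebra ℂ (CrossedProduct G X) :=
  (CrossedProduct.ofFun G X).range

end CrossedProduct

/-! ### Normalizers, diagonal matrices, order zero maps -/

/-- The set of normalizers of `D` in `A`: those `a` with `a^* D a ⊆ D` and `a D a^* ⊆ D`. -/
def normalizers {A : Type*} [Semiring A] [StarRing A] [Algebra ℂ A] [StarModule ℂ A]
    (D : StarSubalgebra ℂ A) : Set A :=
  {a | ∀ d ∈ D, star a * d * a ∈ D ∧ a * d * star a ∈ D}

/-- The subalgebra `D_n` of diagonal matrices in `M_n`. -/
def diagonalMatrices (n : ℕ) : StarSubalgebra ℂ (CStarMatrix (Fin n) (Fin n) ℂ) where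
  carrier := {M | ∀ i j, i ≠ j → M i j = 0}
  mul_mem' {M N} hM hN i j hij := by
    rw [CStarMatrix.mul_apply]
    refine Finset.sum_eq_zero fun k _ => ?_
    by_cases hik : i = k
    · subst hik
      rw [hN _ _ hij, mul_zero]
    · rw [hM _ _ hik, zero_mul]
  add_mem' {M N} hM hN i j hij := by
    rw [CStarMatrix.add_apply, hM i j hij, hN i j hij, add_zero]
  algebraMap_mem' c i j hij := by
    rw [CStarMatrix.algebraMap_apply, if_neg hij]
  star_mem' {M} hM i j hij := by
    rw [CStarMatrix.star_apply, hM j i hij.symm, star_zero]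

/-- The matrix unit `e_{ij}` of `M_n`. -/
def matrixUnit {n : ℕ} (i j : Fin n) : CStarMatrix (Fin n) (Fin n) ℂ :=
  CStarMatrix.ofMatrix (Matrix.single i j 1)

/-- A completely positive contractive (c.p.c.) order zero map between C⋆-algebras: it sends
orthogonal positive elements to orthogonal elements. -/
structure IsCPCOrderZero {A B : Type*} [NonUnitalCStarAlgebra A] [PartialOrder A] [StarOrderedRing A]
    [NonUnitalCStarAlgebra B] [PartialOrder B] [StarOrderedRing B] (φ : A →ₗ[ℂ] B) : Prop where
  completelyPositive : ∃ ψ : A →CP B, ψ.toLinearMap = φ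
  contractive : ∀ a, ‖φ a‖ ≤ ‖a‖
  orderZero : ∀ a b : A, 0 ≤ a → 0 ≤ b → a * b = 0 → φ a * φ b = 0

/-! ### Castles -/

/-- A castle for `G ↷ X`: a family of towers `(V i, S i)` with base `V i ⊆ X` and finite shape
`S i ⊆ G`, such that the levels `s V i` (`i ∈ I`, `s ∈ S i`) are pairwise disjoint. -/
structure IsCastle {G : Type u} {X : Type v} [Group G] [MulAction G X] {I : Type*}
    (V : I → Set X) (S : I → Set G) : Prop where
  finite_shape : ∀ i, (S i).Finite
  disjoint_levels : ∀ i j, ∀ s ∈ S i, ∀ t ∈ S j, (i, s) ≠ (j, t) → Disjoint (s • V i) (t • V j)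

open Classical in
/-- For a real function `f` on `X` and a continuous `θ : supp° f → 𝕋`, where `supp° f = {f ≠ 0}`,
the function `θ f` on `X`, understood as `0` off `supp° f`. -/
def phaseMul {X : Type v} [TopologicalSpace X] (f : C(X, ℝ))
    (θ : C(Function.support f, Circle)) : C(X, ℂ) where
  toFun x := if h : x ∈ Function.support f then (θ ⟨x, h⟩ : ℂ) * (f x : ℂ) else 0
  continuous_toFun := by
    rw [continuous_iff_continuousAt]
    intro x
    by_cases hx : x ∈ Function.support f
    · have hopen : IsOpen (Function.support f) := f.continuous.isOpen_support
      have hc : ContinuousOn (fun x => if h : x ∈ Function.support f then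
          (θ ⟨x, h⟩ : ℂ) * (f x : ℂ) else 0) (Function.support f) := by
        refine continuousOn_iff_continuous_domRestrict.2 ?_
        have h1 : Continuous fun y : Function.support f => (θ y : ℂ) * (f y : ℂ) := by fun_prop
        exact h1.congr fun y => ((dif_pos y.2 : (if h : (y : X) ∈ Function.support f then
          (θ ⟨y, h⟩ : ℂ) * (f y : ℂ) else 0) = _)).symm
      exact hc.continuousAt (hopen.mem_nhds hx)
    · have hfx : f x = 0 := by simpa using hx
      have h0 : Tendsto (fun y => ‖f y‖) (𝓝 x) (𝓝 0) := by
        have := (f.continuous.norm).tendsto x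
        simpa [hfx] using this
      have h1 : Tendsto (fun x => if h : x ∈ Function.support f then
          (θ ⟨x, h⟩ : ℂ) * (f x : ℂ) else 0) (𝓝 x) (𝓝 0) := by
        refine squeeze_zero_norm (fun y => ?_) h0
        by_cases h : y ∈ Function.support f
        · refine (congrArg norm (dif_pos h)).trans_le ?_
          rw [norm_mul, Circle.norm_coe, one_mul, Complex.norm_real]
        · refine (congrArg norm (dif_neg h)).trans_le ?_
          rw [norm_zero]
          exact norm_nonneg _
      have h2 := (dif_neg hx : (if h : x ∈ Function.support f then
          (θ ⟨x, h⟩ : ℂ) * (f x : ℂ) else 0) = 0)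
      exact (congrArg (fun c => Tendsto _ (𝓝 x) (𝓝 c)) h2).mpr h1

/-- A linear map `φ : M_n → C(X) ⋊ G` is a castle order zero map if there are a countable set `T`,
functions `f_t ∈ C(X)_+`, shapes `S_t = {s_{t,1}, …, s_{t,n}} ⊆ G` of size `n` and continuous
functions `θ_{t,i} : supp° f_t → 𝕋` such that `‖f_t‖ → 0`, `(supp° f_t, S_t)_t` is a castle, and
`φ(e_{ij}) = ∑_t u_{s_{t,i}} θ_{t,i} θ̄_{t,j} f_t u_{s_{t,j}}^*`, the sum converging in norm.
(In the group of `𝕋`-valued functions, `θ⁻¹` is the complex conjugate of `θ`.) -/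
def IsCastleOrderZeroMap {G : Type u} {X : Type v} [Group G] [TopologicalSpace X] [CompactSpace X]
    [MulAction G X] [ContinuousConstSMul G X] {n : ℕ}
    (φ : CStarMatrix (Fin n) (Fin n) ℂ →ₗ[ℂ] CrossedProduct G X) : Prop :=
  ∃ (T : Type) (_ : Countable T) (f : T → C(X, ℝ)) (s : T → Fin n → G)
    (θ : ∀ t : T, Fin n → C(Function.support (f t), Circle)),
    (∀ t, 0 ≤ f t) ∧
    (∀ t, Function.Injective (s t)) ∧
    Tendsto (fun t => ‖f t‖) cofinite (𝓝 0) ∧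
    IsCastle (fun t => Function.support (f t)) (fun t => Set.range (s t)) ∧
    ∀ i j : Fin n, HasSum
      (fun t => CrossedProduct.u G X (s t i) *
        CrossedProduct.ofFun G X (phaseMul (f t) (θ t i * (θ t j)⁻¹)) *
        star (CrossedProduct.u G X (s t j)))
      (φ (matrixUnit i j))

end

-- On a free orbit an element of the crossed product acts on `ℓ²(G)` as a matrix whose `(g, h)`
-- entry at `x` is `entry x g h a`. These entries are continuous in `x`, obey matrix multiplication,
-- and, since `G` is amenable, determine `a` (`eq_zero_of_entry_eq_zero`). If `v` normalizes `C(X)`,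
-- then `v^* d v` is diagonal for every `d`. Freeness lets `d` separate the points of the orbit, so
-- each row and column of `v` has at most one nonzero entry (`entry_mul_entry_eq_zero_of_row`,
-- `entry_mul_entry_eq_zero_of_column`): `v` is a weighted partial permutation of every orbit.
--
-- The order zero property makes `E_ij = φ(e_ij)` behave like matrix units with weights: `E_ij^* =
-- E_ji`, `E_ij E_kl = 0` for `j ≠ k`, and `E_ij E_jl` does not depend on `j`. Each `E_jj` is a
-- positive normalizer, hence a function `e_j`. The relation `E_ij^* E_ij = e_j²` forces the single
-- nonzero entry in a column of `E_ij` to have modulus `e_j`.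
--
-- Fix an index `i₀`. A point `x` with `e_{i₀}(x) ≠ 0` has a unique shape `(t_i)`, where `t_i` is
-- the row of the nonzero entry in column `1` of `E_{i i₀}`. The points of shape `t` form an open
-- set, the base of a tower; on it `f_t = e_{i₀}`, and `θ_{t,i}` is the phase of that entry.
-- Uniqueness of nonzero entries gives the castle, compactness of `{e_{i₀} ≥ ε}` gives `‖f_t‖ → 0`,
-- orthogonality of the summands gives convergence, and comparison of entries (`hasSum_entry_tower`)
-- identifies the sum.

universe w

noncomputable section

/-! ### Order zero maps on matrix units. -/

section OrderZero

variable {A : Type*} [CStarAlgebra A] [PartialOrder A] [StarOrderedRing A]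

/-- Multiplying by `y^*` on the left gives a vanishing sum of positive elements `(p_a y)^* (p_a y)`,
so each of them is zero. -/
theorem mul_eq_zero_of_sum_star_mul_self_mul_eq_zero {ι : Type*} [Fintype ι] {p : ι → A} {y : A}
    (h : (∑ a, star (p a) * p a) * y = 0) (a : ι) : p a * y = 0 := by
  have h1 : ∑ a, star (p a * y) * (p a * y) = 0 := by
    have : ∑ a, star (p a * y) * (p a * y) = star y * ((∑ a, star (p a) * p a) * y) := by
      simp only [Finset.sum_mul, Finset.mul_sum, star_mul, mul_assoc]
    rw [this, h, mul_zero]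
  have h2 := (Finset.sum_eq_zero_iff_of_nonneg
    (fun a _ => star_mul_self_nonneg (p a * y))).1 h1 a (Finset.mem_univ a)
  exact CStarRing.star_mul_self_eq_zero_iff _ |>.1 h2

theorem mul_star_eq_zero_of_sum_mul_sum_eq_zero {ι : Type*} [Fintype ι] {p q : ι → A}
    (h : (∑ a, star (p a) * p a) * (∑ b, star (q b) * q b) = 0) (a b : ι) :
    p a * star (q b) = 0 := by
  have h1 := mul_eq_zero_of_sum_star_mul_self_mul_eq_zero h a
  have h2 : (∑ b, star (q b) * q b) * star (p a) = 0 := by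
    have := congrArg star h1
    simpa [star_mul, star_sum] using this
  have h3 := congrArg star (mul_eq_zero_of_sum_star_mul_self_mul_eq_zero h2 b)
  simpa using h3

variable {n : ℕ}

theorem matrixUnit_apply (i j a b : Fin n) :
    matrixUnit i j a b = if i = a ∧ j = b then 1 else 0 := by
  change Matrix.single i j (1 : ℂ) a b = _
  rw [Matrix.single_apply]

theorem matrixUnit_mul (i j k l : Fin n) :
    matrixUnit i j * matrixUnit k l = if j = k then matrixUnit i l else 0 := by
  change CStarMatrix.ofMatrix (Matrix.single i j (1 : ℂ) * Matrix.single k l 1) = _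
  split_ifs with h
  · subst h
    simp [matrixUnit]
  · simp [h]

theorem star_matrixUnit (i j : Fin n) : star (matrixUnit i j) = matrixUnit j i := by
  ext a b
  rw [CStarMatrix.star_apply, matrixUnit_apply, matrixUnit_apply]
  split_ifs <;> simp_all

theorem matrixUnit_mem_normalizers (i j : Fin n) :
    matrixUnit i j ∈ normalizers (diagonalMatrices n) := by
  have key : ∀ (i j : Fin n) (d : CStarMatrix (Fin n) (Fin n) ℂ),
      matrixUnit i j * d * matrixUnit j i ∈ diagonalMatrices n := by
    intro i j d a b hab
    have : matrixUnit i j * d * matrixUnit j i = d j j • matrixUnit i i := by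
      ext a b
      simp only [CStarMatrix.mul_apply, matrixUnit_apply, CStarMatrix.smul_apply, smul_eq_mul]
      rw [Finset.sum_eq_single j]
      · rw [Finset.sum_eq_single j]
        · by_cases h1 : i = a <;> by_cases h2 : i = b <;> simp [h1, h2]
        · intro k _ hk; simp [hk.symm]
        · simp
      · intro k _ hk; simp [hk.symm]
      · simp
    rw [this, CStarMatrix.smul_apply, matrixUnit_apply, if_neg (by grind), smul_zero]
  intro d _
  rw [star_matrixUnit]
  exact ⟨key j i d, key i j d⟩

theorem exists_eq_star_mul_self_of_nonneg {B : Type*} [NonUnitalCStarAlgebra B] [PartialOrder B]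
    [StarOrderedRing B] {b : B} (hb : 0 ≤ b) : ∃ s : B, b = star s * s :=
  CStarAlgebra.nonneg_iff_eq_star_mul_self.1 hb

/-- The images of the matrix units under an order zero map factor as `S_i^* S_j`. -/
theorem IsCPCOrderZero.exists_factorization {φ : CStarMatrix (Fin n) (Fin n) ℂ →ₗ[ℂ] A}
    (hφ : IsCPCOrderZero φ) :
    ∃ S : Fin n → Fin n → A, ∀ i j, φ (matrixUnit i j) = ∑ a, star (S a i) * S a j := by
  rcases isEmpty_or_nonempty (Fin n) with hn | ⟨⟨i₀⟩⟩
  · exact ⟨fun _ _ => 0, fun i => hn.elim i⟩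
  obtain ⟨ψ, rfl⟩ := hφ.completelyPositive
  -- Only row `i₀` of `N` is nonzero, chosen so that `N^* N` is the block matrix `(e_ij)`. Complete
  -- positivity then makes `(φ(e_ij))` positive, and a square root supplies `S`.
  let N : CStarMatrix (Fin n) (Fin n) (CStarMatrix (Fin n) (Fin n) ℂ) :=
    CStarMatrix.ofMatrix (Matrix.of fun a b => if a = i₀ then matrixUnit i₀ b else 0)
  have hN : ∀ a b, N a b = if a = i₀ then matrixUnit i₀ b else 0 := fun _ _ => rfl
  have h1 := ψ.map_cstarMatrix_nonneg' n _ (star_mul_self_nonneg N)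
  obtain ⟨S, hS⟩ := exists_eq_star_mul_self_of_nonneg h1
  refine ⟨fun a b => S a b, fun i j => ?_⟩
  have h2 : (star N * N) i j = matrixUnit i j := by
    rw [CStarMatrix.mul_apply, Finset.sum_eq_single i₀]
    · rw [CStarMatrix.star_apply, hN, hN, if_pos rfl, if_pos rfl, star_matrixUnit,
        matrixUnit_mul, if_pos rfl]
    · intro b _ hb
      rw [hN b j, if_neg hb, mul_zero]
    · simp
  have h3 := congrArg (fun M : CStarMatrix (Fin n) (Fin n) A => M i j) hS
  simp only [CStarMatrix.map_apply, h2] at h3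
  rw [h3, CStarMatrix.mul_apply]
  simp only [CStarMatrix.star_apply]

theorem matrixUnit_self_nonneg (i : Fin n) : 0 ≤ matrixUnit i i := by
  have := star_mul_self_nonneg (matrixUnit i i)
  rwa [star_matrixUnit, matrixUnit_mul, if_pos rfl] at this

theorem IsCPCOrderZero.map_matrixUnit_self_nonneg {φ : CStarMatrix (Fin n) (Fin n) ℂ →ₗ[ℂ] A}
    (hφ : IsCPCOrderZero φ) (i : Fin n) : 0 ≤ φ (matrixUnit i i) := by
  obtain ⟨S, hS⟩ := hφ.exists_factorization
  rw [hS]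
  exact Finset.sum_nonneg fun a _ => star_mul_self_nonneg _

theorem IsCPCOrderZero.star_map_matrixUnit {φ : CStarMatrix (Fin n) (Fin n) ℂ →ₗ[ℂ] A}
    (hφ : IsCPCOrderZero φ) (i j : Fin n) :
    star (φ (matrixUnit i j)) = φ (matrixUnit j i) := by
  obtain ⟨S, hS⟩ := hφ.exists_factorization
  simp [hS, star_sum]

/-- Orthogonality of `φ(e_jj)` and `φ(e_kk)` passes to the factors as `S_aj S_bk^* = 0`, which sits
in the middle of every term of the product. -/
theorem IsCPCOrderZero.map_matrixUnit_mul_of_ne {φ : CStarMatrix (Fin n) (Fin n) ℂ →ₗ[ℂ] A}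
    (hφ : IsCPCOrderZero φ) (i : Fin n) {j k : Fin n} (l : Fin n) (hjk : j ≠ k) :
    φ (matrixUnit i j) * φ (matrixUnit k l) = 0 := by
  obtain ⟨S, hS⟩ := hφ.exists_factorization
  have h0 := hφ.orderZero _ _ (matrixUnit_self_nonneg j) (matrixUnit_self_nonneg k)
    (by rw [matrixUnit_mul, if_neg hjk])
  rw [hS, hS] at h0
  have h1 := mul_star_eq_zero_of_sum_mul_sum_eq_zero h0
  rw [hS, hS, Finset.sum_mul_sum]
  refine Finset.sum_eq_zero fun a _ => Finset.sum_eq_zero fun b _ => ?_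
  rw [mul_assoc, ← mul_assoc (S a j), h1, zero_mul, mul_zero]

/-- In terms of the factors this amounts to `S_aj S_bj^* = S_ak S_bk^*`, which comes from orthogonal
positive matrices supported on the indices `j, k`. -/
theorem IsCPCOrderZero.map_matrixUnit_mul {φ : CStarMatrix (Fin n) (Fin n) ℂ →ₗ[ℂ] A}
    (hφ : IsCPCOrderZero φ) (i j k l : Fin n) :
    φ (matrixUnit i j) * φ (matrixUnit j l) = φ (matrixUnit i k) * φ (matrixUnit k l) := by
  rcases eq_or_ne j k with rfl | hjk
  · rfl
  obtain ⟨S, hS⟩ := hφ.exists_factorization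
  have h1 : ∀ {j k}, j ≠ k → ∀ a b, S a j * star (S b k) = 0 := fun {j k} hjk => by
    have h0 := hφ.orderZero _ _ (matrixUnit_self_nonneg j) (matrixUnit_self_nonneg k)
      (by rw [matrixUnit_mul, if_neg hjk])
    rw [hS, hS] at h0
    exact mul_star_eq_zero_of_sum_mul_sum_eq_zero h0
  have hpos : ∀ c : ℂ, (matrixUnit j j + c • matrixUnit j k + star c • matrixUnit k j
      + (star c * c) • matrixUnit k k) =
      star (matrixUnit j j + c • matrixUnit j k) * (matrixUnit j j + c • matrixUnit j k) := by
    intro c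
    simp only [star_add, star_smul, star_matrixUnit, add_mul, mul_add, smul_mul_assoc,
      mul_smul_comm, matrixUnit_mul, if_true]
    module
  have hsum : ∀ c : ℂ, φ (matrixUnit j j + c • matrixUnit j k + star c • matrixUnit k j
      + (star c * c) • matrixUnit k k) =
      ∑ a, star (S a j + c • S a k) * (S a j + c • S a k) := by
    intro c
    simp only [map_add, map_smul, hS, Finset.smul_sum, ← Finset.sum_add_distrib]
    refine Finset.sum_congr rfl fun a _ => ?_
    simp only [star_add, star_smul, add_mul, mul_add, smul_mul_assoc, mul_smul_comm]
    module
  have hnn : ∀ c : ℂ, 0 ≤ (matrixUnit j j + c • matrixUnit j k + star c • matrixUnit k j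
      + (star c * c) • matrixUnit k k) := fun c => by
    rw [hpos]; exact star_mul_self_nonneg _
  -- The choices `c = 1` and `c = -1` give multiples of the projections onto the orthogonal vectors
  -- `(1, 1)` and `(1, -1)`.
  have h2 := hφ.orderZero _ _ (hnn 1) (hnn (-1)) (by
    simp [add_mul, mul_add, matrixUnit_mul, hjk, hjk.symm]
    abel)
  rw [hsum, hsum] at h2
  have h3 : ∀ a b, S a j * star (S b j) = S a k * star (S b k) := by
    intro a b
    have := mul_star_eq_zero_of_sum_mul_sum_eq_zero h2 a b
    simp only [one_smul, neg_smul, star_add, star_neg, add_mul, mul_add, mul_neg,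
      h1 hjk, h1 hjk.symm] at this
    rw [← sub_eq_zero, ← this]
    abel
  rw [hS, hS, hS, hS, Finset.sum_mul_sum, Finset.sum_mul_sum]
  refine Finset.sum_congr rfl fun a _ => Finset.sum_congr rfl fun b _ => ?_
  rw [mul_assoc, ← mul_assoc (S a j), h3, mul_assoc, mul_assoc]

end OrderZero

/-! ### Translation of functions and the regular covariant representations. -/

section TranslateFun

variable {G : Type u} {X : Type v} [Group G] [TopologicalSpace X] [MulAction G X]
  [ContinuousConstSMul G X]


theorem translateFun_apply (g : G) (f : C(X, ℂ)) (x : X) : translateFun g f x = f (g⁻¹ • x) := rfl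

theorem translateFun_add (g : G) (f f' : C(X, ℂ)) :
    translateFun g (f + f') = translateFun g f + translateFun g f' := rfl

theorem translateFun_mul (g : G) (f f' : C(X, ℂ)) :
    translateFun g (f * f') = translateFun g f * translateFun g f' := rfl

theorem translateFun_star (g : G) (f : C(X, ℂ)) :
    translateFun g (star f) = star (translateFun g f) := rfl

theorem translateFun_translateFun (g h : G) (f : C(X, ℂ)) :
    translateFun g (translateFun h f) = translateFun (g * h) f := by
  ext x
  simp [translateFun_apply, mul_smul]

end TranslateFun

section RegularRep

variable {G : Type u} {X : Type v} [Group G] [TopologicalSpace X] [CompactSpace X]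
  [MulAction G X] [ContinuousConstSMul G X]
  {K : Type*} [NormedAddCommGroup K] [InnerProductSpace ℂ K] [CompleteSpace K]

theorem norm_translateFun_le (g : G) (f : C(X, ℂ)) : ‖translateFun g f‖ ≤ ‖f‖ :=
  (ContinuousMap.norm_le _ (norm_nonneg _)).2 fun x => f.norm_coe_le_norm (g⁻¹ • x)

/-- Multiplication by `f` in the regular representation of `(X, G)` induced from a representation
`π` of `C(X)`: the operator `(ξ_g)_g ↦ (π(f ∘ α_g) ξ_g)_g` on `ℓ²(G, K)`. -/
def regularMul (π : C(X, ℂ) →⋆ₐ[ℂ] (K →L[ℂ] K)) (f : C(X, ℂ)) :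
    lp (fun _ : G => K) 2 →L[ℂ] lp (fun _ : G => K) 2 :=
  have key : ∀ (ξ : lp (fun _ : G => K) 2) (g : G),
      ‖π (translateFun g⁻¹ f) (ξ g)‖ ≤ ‖(((‖f‖ : ℝ) : ℂ) • ξ) g‖ := fun ξ g => by
    refine (ContinuousLinearMap.le_opNorm _ _).trans ?_
    rw [lp.coeFn_smul, Pi.smul_apply, norm_smul, Complex.norm_real, norm_norm]
    gcongr
    exact (NonUnitalStarAlgHom.norm_apply_le π _).trans (norm_translateFun_le _ _)
  LinearMap.mkContinuous
    { toFun := fun ξ => ⟨fun g => π (translateFun g⁻¹ f) (ξ g),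
        (lp.memℓp (((‖f‖ : ℝ) : ℂ) • ξ)).mono' (key ξ)⟩
      map_add' := fun ξ η => by ext g; exact map_add _ _ _
      map_smul' := fun c ξ => by ext g; simp } ‖f‖ fun ξ => by
    refine (lp.norm_mono (by norm_num) (key ξ)).trans ?_
    rw [norm_smul, Complex.norm_real, norm_norm]

theorem regularMul_apply (π : C(X, ℂ) →⋆ₐ[ℂ] (K →L[ℂ] K)) (f : C(X, ℂ))
    (ξ : lp (fun _ : G => K) 2) (g : G) :
    regularMul π f ξ g = π (translateFun g⁻¹ f) (ξ g) := rfl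

theorem regularMul_star (π : C(X, ℂ) →⋆ₐ[ℂ] (K →L[ℂ] K)) (f : C(X, ℂ)) :
    regularMul (G := G) π (star f) = star (regularMul π f) := by
  rw [ContinuousLinearMap.star_eq_adjoint, ContinuousLinearMap.eq_adjoint_iff]
  intro ξ η
  rw [lp.inner_eq_tsum, lp.inner_eq_tsum]
  refine tsum_congr fun g => ?_
  rw [regularMul_apply, regularMul_apply, translateFun_star, map_star,
    ContinuousLinearMap.star_eq_adjoint, ContinuousLinearMap.adjoint_inner_left]

/-- The translation operator `(ξ_h)_h ↦ (ξ_{g⁻¹h})_h` on `ℓ²(G, K)`. -/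
def regularTranslation (g : G) : lp (fun _ : G => K) 2 →ₗᵢ[ℂ] lp (fun _ : G => K) 2 where
  toFun ξ := ⟨fun h => ξ (g⁻¹ * h), memℓp_gen <|
    ((lp.memℓp ξ).summable (by norm_num)).comp_injective (mul_right_injective g⁻¹)⟩
  map_add' ξ η := by ext h; rfl
  map_smul' c ξ := by ext h; rfl
  norm_map' ξ := by
    have h2 : (0 : ℝ) < (2 : ℝ≥0∞).toReal := by norm_num
    rw [lp.norm_eq_tsum_rpow h2, lp.norm_eq_tsum_rpow h2]
    congr 1
    exact (Equiv.mulLeft g⁻¹).tsum_eq (fun h => ‖ξ h‖ ^ (2 : ℝ≥0∞).toReal)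

variable (G K) in
/-- The regular representation of `G` on `ℓ²(G, K)`. -/
def regularUnitary :
    G →* unitary (lp (fun _ : G => K) 2 →L[ℂ] lp (fun _ : G => K) 2) :=
  MonoidHom.comp Unitary.linearIsometryEquiv.symm.toMonoidHom
    { toFun := fun g => LinearIsometryEquiv.ofSurjective (regularTranslation g) fun ξ =>
        ⟨regularTranslation g⁻¹ ξ, by
          ext h
          change ξ (g⁻¹⁻¹ * (g⁻¹ * h)) = ξ h
          rw [inv_inv, mul_inv_cancel_left]⟩
      map_one' := by
        ext ξ h
        change ξ (1⁻¹ * h) = ξ h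
        rw [inv_one, one_mul]
      map_mul' := fun g g' => by
        ext ξ h
        change ξ ((g * g')⁻¹ * h) = ξ (g'⁻¹ * (g⁻¹ * h))
        rw [mul_inv_rev, mul_assoc] }

end RegularRep

section RegularCovariantRep

variable {G : Type u} {X : Type v} [Group G] [TopologicalSpace X] [CompactSpace X]
  [MulAction G X] [ContinuousConstSMul G X]
  {K : Type (max u v)} [NormedAddCommGroup K] [InnerProductSpace ℂ K] [CompleteSpace K]
  [Nontrivial K]

instance regularSpace.instNontrivial : Nontrivial (lp (fun _ : G => K) 2) := by
  classical
  obtain ⟨k, hk⟩ := exists_ne (0 : K)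
  refine ⟨⟨lp.single 2 1 k, 0, fun h => hk ?_⟩⟩
  simpa using congrArg (fun ξ : lp (fun _ : G => K) 2 => ξ 1) h

variable (G) in
/-- The regular covariant representation induced from a representation of `C(X)`. -/
def regularRep (π : C(X, ℂ) →⋆ₐ[ℂ] (K →L[ℂ] K)) : CovariantRep.{u, v} G X where
  H := lp (fun _ : G => K) 2
  π :=
    { toFun := regularMul π
      map_one' := by
        ext ξ g
        rw [regularMul_apply, show translateFun g⁻¹ (1 : C(X, ℂ)) = 1 from rfl, map_one]
        rfl
      map_mul' := fun f f' => by
        ext ξ g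
        rw [regularMul_apply, translateFun_mul, map_mul]
        rfl
      map_zero' := by
        ext ξ g
        rw [regularMul_apply, show translateFun g⁻¹ (0 : C(X, ℂ)) = 0 from rfl, map_zero]
        rfl
      map_add' := fun f f' => by
        ext ξ g
        rw [regularMul_apply, translateFun_add, map_add]
        rfl
      commutes' := fun c => by
        ext ξ g
        rw [regularMul_apply, show translateFun g⁻¹ (algebraMap ℂ C(X, ℂ) c) =
          algebraMap ℂ C(X, ℂ) c from rfl, AlgHomClass.commutes]
        rfl
      map_star' := regularMul_star π }
  U := regularUnitary G K
  covariant g f := by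
    have h : (regularUnitary G K g : lp (fun _ : G => K) 2 →L[ℂ] _) * regularMul π f =
        regularMul π (translateFun g f) *
          (regularUnitary G K g : lp (fun _ : G => K) 2 →L[ℂ] _) := by
      ext ξ h
      change regularMul π f ξ (g⁻¹ * h) =
        π (translateFun h⁻¹ (translateFun g f)) (ξ (g⁻¹ * h))
      rw [regularMul_apply, translateFun_translateFun, mul_inv_rev, inv_inv]
    change (regularUnitary G K g : lp (fun _ : G => K) 2 →L[ℂ] _) * regularMul π f * _ =
      regularMul π _
    rw [h, mul_assoc, Unitary.mul_star_self_of_mem (regularUnitary G K g).2, mul_one]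

end RegularCovariantRep

/-! ### Dense span of the `f u_g` and matrix coefficients. -/

namespace CrossedProduct

section Basic

variable {G : Type u} {X : Type v} [Group G] [TopologicalSpace X] [CompactSpace X]
  [MulAction G X] [ContinuousConstSMul G X]

/-- The representation of the crossed product given by a covariant representation. -/
def rep (ρ : CovariantRep.{u, v} G X) : CrossedProduct G X →⋆ₐ[ℂ] (ρ.H →L[ℂ] ρ.H) where
  toFun a := (show crossedProductSubalgebra G X from a).1 ρ
  map_one' := rfl
  map_mul' _ _ := rfl
  map_zero' := rfl
  map_add' _ _ := rfl
  commutes' _ := rfl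
  map_star' _ := rfl

theorem rep_ofFun (ρ : CovariantRep.{u, v} G X) (f : C(X, ℂ)) : rep ρ (ofFun G X f) = ρ.π f := rfl

theorem rep_u (ρ : CovariantRep.{u, v} G X) (g : G) : rep ρ (u G X g) = ρ.U g := rfl

theorem norm_rep_le (ρ : CovariantRep.{u, v} G X) (a : CrossedProduct G X) : ‖rep ρ a‖ ≤ ‖a‖ :=
  lp.norm_apply_le_norm ENNReal.top_ne_zero (show crossedProductSubalgebra G X from a).1 ρ

theorem ext_rep {a b : CrossedProduct G X} (h : ∀ ρ : CovariantRep.{u, v} G X, rep ρ a = rep ρ b) :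
    a = b :=
  Subtype.ext (lp.ext (funext h))

theorem u_mul (g h : G) : u G X (g * h) = u G X g * u G X h :=
  ext_rep fun ρ => by simp [rep_u]

theorem u_one : u G X (1 : G) = 1 :=
  ext_rep fun ρ => by simp [rep_u]

theorem star_u (g : G) : star (u G X g) = u G X g⁻¹ :=
  ext_rep fun ρ => by
    rw [map_star, rep_u, rep_u, map_inv, ← Unitary.star_eq_inv, Unitary.coe_star]

theorem u_mul_ofFun (g : G) (f : C(X, ℂ)) :
    u G X g * ofFun G X f = ofFun G X (translateFun g f) * u G X g :=
  ext_rep fun ρ => by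
    rw [map_mul, map_mul, rep_u, rep_ofFun, rep_ofFun, ← ρ.covariant, mul_assoc,
      Unitary.star_mul_self_of_mem (ρ.U g).2, mul_one]

variable (G X) in
/-- The linear span of the elements `f u_g`. -/
def algebraicSpan : Submodule ℂ (CrossedProduct G X) :=
  Submodule.span ℂ (Set.range fun p : C(X, ℂ) × G => ofFun G X p.1 * u G X p.2)

theorem ofFun_mul_u_mem (f : C(X, ℂ)) (g : G) : ofFun G X f * u G X g ∈ algebraicSpan G X :=
  Submodule.subset_span ⟨(f, g), rfl⟩

theorem mul_mem_algebraicSpan {a b : CrossedProduct G X} (ha : a ∈ algebraicSpan G X)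
    (hb : b ∈ algebraicSpan G X) : a * b ∈ algebraicSpan G X := by
  have h := Submodule.mul_mem_mul ha hb
  rw [algebraicSpan, Submodule.span_mul_span] at h
  refine Submodule.span_mono ?_ h
  rintro _ ⟨_, ⟨⟨f, g⟩, rfl⟩, _, ⟨⟨f', g'⟩, rfl⟩, rfl⟩
  refine ⟨(f * translateFun g f', g * g'), ?_⟩
  change ofFun G X (f * translateFun g f') * u G X (g * g') =
    ofFun G X f * u G X g * (ofFun G X f' * u G X g')
  rw [map_mul, u_mul, mul_assoc, mul_assoc, ← mul_assoc (u G X g), u_mul_ofFun, mul_assoc]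

theorem star_mem_algebraicSpan {a : CrossedProduct G X} (ha : a ∈ algebraicSpan G X) :
    star a ∈ algebraicSpan G X := by
  induction ha using Submodule.span_induction with
  | mem a ha =>
    obtain ⟨⟨f, g⟩, rfl⟩ := ha
    change star (ofFun G X f * u G X g) ∈ _
    rw [star_mul, star_u, ← map_star, u_mul_ofFun]
    exact ofFun_mul_u_mem _ _
  | zero => rw [star_zero]; exact zero_mem _
  | add a b _ _ ha hb => rw [star_add]; exact add_mem ha hb
  | smul c a _ ha => rw [star_smul]; exact Submodule.smul_mem _ _ ha

/-- The span is closed under products and adjoints and contains the generators, so it exhausts the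
algebra whose closure defines the crossed product. -/
theorem dense_algebraicSpan : Dense (algebraicSpan G X : Set (CrossedProduct G X)) := by
  intro a
  have h1 : ∀ b ∈ StarAlgebra.adjoin ℂ (Set.range (CovariantFamilies.ofFun G X) ∪
      Set.range (fun g : G => (CovariantFamilies.ofGroup G X g : CovariantFamilies G X))),
      ∃ c ∈ algebraicSpan G X, (show crossedProductSubalgebra G X from c).1 = b := by
    intro b hb
    induction hb using StarAlgebra.adjoin_induction with
    | mem b hb =>
      rcases hb with ⟨f, rfl⟩ | ⟨g, rfl⟩
      · refine ⟨ofFun G X f, ?_, rfl⟩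
        simpa [u_one] using ofFun_mul_u_mem f (1 : G)
      · refine ⟨u G X g, ?_, rfl⟩
        simpa using ofFun_mul_u_mem (1 : C(X, ℂ)) g
    | algebraMap r =>
      refine ⟨algebraMap ℂ _ r, ?_, rfl⟩
      have h := ofFun_mul_u_mem (algebraMap ℂ C(X, ℂ) r) (1 : G)
      rwa [u_one, mul_one, AlgHomClass.commutes] at h
    | add b b' _ _ hb hb' =>
      obtain ⟨c, hc, rfl⟩ := hb
      obtain ⟨c', hc', rfl⟩ := hb'
      exact ⟨c + c', add_mem hc hc', rfl⟩
    | mul b b' _ _ hb hb' =>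
      obtain ⟨c, hc, rfl⟩ := hb
      obtain ⟨c', hc', rfl⟩ := hb'
      exact ⟨c * c', mul_mem_algebraicSpan hc hc', rfl⟩
    | star b _ hb =>
      obtain ⟨c, hc, rfl⟩ := hb
      exact ⟨star c, star_mem_algebraicSpan hc, rfl⟩
  rw [Metric.mem_closure_iff]
  intro ε hε
  have h2 : (show crossedProductSubalgebra G X from a).1 ∈
    closure (StarAlgebra.adjoin ℂ (Set.range (CovariantFamilies.ofFun G X) ∪
      Set.range (fun g : G => (CovariantFamilies.ofGroup G X g : CovariantFamilies G X))) :
      Set (CovariantFamilies G X)) := (show crossedProductSubalgebra G X from a).2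
  obtain ⟨b, hb, hab⟩ := Metric.mem_closure_iff.1 h2 ε hε
  obtain ⟨c, hc, rfl⟩ := h1 b hb
  exact ⟨c, hc, hab⟩

theorem continuousLinearMap_ext {E : Type*} [NormedAddCommGroup E] [NormedSpace ℂ E]
    {S T : CrossedProduct G X →L[ℂ] E}
    (h : ∀ f g, S (ofFun G X f * u G X g) = T (ofFun G X f * u G X g)) : S = T :=
  ContinuousLinearMap.ext_on dense_algebraicSpan (by rintro _ ⟨⟨f, g⟩, rfl⟩; exact h f g)

/-- The matrix coefficient `⟪ξ, ρ(a) η⟫` as a functional of `a`. -/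
def coeff (ρ : CovariantRep.{u, v} G X) (ξ η : ρ.H) : CrossedProduct G X →L[ℂ] ℂ :=
  LinearMap.mkContinuous
    { toFun := fun a => inner ℂ ξ (rep ρ a η)
      map_add' := fun a b => by simp
      map_smul' := fun c a => by simp } (‖ξ‖ * ‖η‖) fun a => by
    refine (norm_inner_le_norm _ _).trans ?_
    rw [mul_assoc, mul_comm ‖η‖]
    gcongr
    exact ((rep ρ a).le_opNorm η).trans (by gcongr; exact norm_rep_le ρ a)

theorem coeff_apply (ρ : CovariantRep.{u, v} G X) (ξ η : ρ.H) (a : CrossedProduct G X) :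
    coeff ρ ξ η a = inner ℂ ξ (rep ρ a η) := rfl

theorem norm_coeff_le (ρ : CovariantRep.{u, v} G X) (ξ η : ρ.H) (a : CrossedProduct G X) :
    ‖coeff ρ ξ η a‖ ≤ ‖a‖ * (‖ξ‖ * ‖η‖) := by
  rw [mul_comm]
  exact (coeff ρ ξ η).le_of_opNorm_le (LinearMap.mkContinuous_norm_le _ (by positivity) _) a

end Basic

section Regular

variable {G : Type u} {X : Type v} [Group G] [TopologicalSpace X] [CompactSpace X]
  [MulAction G X] [ContinuousConstSMul G X]
  {K : Type (max u v)} [NormedAddCommGroup K] [InnerProductSpace ℂ K] [CompleteSpace K]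
  [Nontrivial K]

open Classical in
/-- The vector `ξ ⊗ δ_g` of the regular representation induced by `π`. -/
def regularSingle (π : C(X, ℂ) →⋆ₐ[ℂ] (K →L[ℂ] K)) (g : G) (ξ : K) : (regularRep G π).H :=
  lp.single (E := fun _ : G => K) 2 g ξ

theorem norm_regularSingle (π : C(X, ℂ) →⋆ₐ[ℂ] (K →L[ℂ] K)) (g : G) (ξ : K) :
    ‖regularSingle π g ξ‖ = ‖ξ‖ := by
  classical
  exact lp.norm_single (E := fun _ : G => K) (by norm_num) g ξ

theorem inner_regularSingle (π : C(X, ℂ) →⋆ₐ[ℂ] (K →L[ℂ] K)) (g : G) (ξ : K)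
    (η : (regularRep G π).H) :
    inner ℂ (regularSingle π g ξ) η = inner ℂ ξ ((show lp (fun _ : G => K) 2 from η) g) := by
  classical
  exact lp.inner_single_left (𝕜 := ℂ) (G := fun _ : G => K) g ξ _

theorem regularSingle_smul (π : C(X, ℂ) →⋆ₐ[ℂ] (K →L[ℂ] K)) (g : G) (c : ℂ) (ξ : K) :
    regularSingle π g (c • ξ) = c • regularSingle π g ξ := by
  classical
  exact lp.single_smul (E := fun _ : G => K) 2 g c ξ

theorem hasSum_regularSingle (π : C(X, ℂ) →⋆ₐ[ℂ] (K →L[ℂ] K)) (η : (regularRep G π).H) :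
    HasSum (fun g => regularSingle π g ((show lp (fun _ : G => K) 2 from η) g)) η := by
  classical
  exact lp.hasSum_single (E := fun _ : G => K) (by norm_num) η

/-- The matrix coefficients of the regular representation induced by `π`. -/
def regularCoeff (π : C(X, ℂ) →⋆ₐ[ℂ] (K →L[ℂ] K)) (g h : G) (ξ η : K) :
    CrossedProduct G X →L[ℂ] ℂ :=
  coeff (regularRep G π) (regularSingle π g ξ) (regularSingle π h η)

theorem regularCoeff_apply (π : C(X, ℂ) →⋆ₐ[ℂ] (K →L[ℂ] K)) (g h : G) (ξ η : K)
    (a : CrossedProduct G X) :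
    regularCoeff π g h ξ η a =
      inner ℂ (regularSingle π g ξ) (rep (regularRep G π) a (regularSingle π h η)) := rfl

open Classical in
theorem regularCoeff_ofFun_mul_u (π : C(X, ℂ) →⋆ₐ[ℂ] (K →L[ℂ] K)) (g h : G) (ξ η : K)
    (f : C(X, ℂ)) (s : G) :
    regularCoeff π g h ξ η (ofFun G X f * u G X s) =
      if g = s * h then inner ℂ ξ (π (translateFun g⁻¹ f) η) else 0 := by
  rw [regularCoeff_apply, inner_regularSingle]
  change inner ℂ ξ (π (translateFun g⁻¹ f) (lp.single (E := fun _ : G => K) 2 h η (s⁻¹ * g))) = _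
  split_ifs with H
  · rw [show s⁻¹ * g = h by rw [H]; group, lp.single_apply_self]
  · rw [lp.single_apply_ne _ _ _ (by rintro rfl; exact H (by group)), map_zero, inner_zero_right]

end Regular

end CrossedProduct

/-! ### Matrix entries along an orbit. -/

namespace CrossedProduct

section Entry

variable {G : Type u} {X : Type v} [Group G] [TopologicalSpace X] [CompactSpace X]
  [MulAction G X] [ContinuousConstSMul G X]

/-- A one-dimensional Hilbert space. -/
abbrev ScalarSpace : Type w := EuclideanSpace ℂ PUnit.{w + 1}

/-- The unit vector spanning `ScalarSpace`. -/
def unitVector : ScalarSpace.{w} := EuclideanSpace.single PUnit.unit 1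

theorem norm_unitVector : ‖unitVector.{w}‖ = 1 := by simp [unitVector]

theorem inner_unitVector_smul (ζ : ScalarSpace.{w}) :
    (inner ℂ unitVector ζ : ℂ) • unitVector = ζ := by
  ext i
  simp [unitVector, EuclideanSpace.inner_single_left]

theorem inner_unitVector_unitVector : inner ℂ unitVector.{w} unitVector.{w} = (1 : ℂ) := by
  rw [inner_self_eq_norm_sq_to_K, norm_unitVector]
  simp

/-- Evaluation at `x`, as a representation of `C(X)` on a one-dimensional Hilbert space. -/
def evalRep {X : Type v} [TopologicalSpace X] (x : X) :
    C(X, ℂ) →⋆ₐ[ℂ] (ScalarSpace.{w} →L[ℂ] ScalarSpace.{w}) :=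
  (StarAlgHom.ofId ℂ _).comp (ContinuousMap.evalStarAlgHom ℂ ℂ x)

/-- The matrix entries of an element of the crossed product in the representation on `ℓ²(G)`
attached to the orbit of a point `x`. -/
def entry (x : X) (g h : G) : CrossedProduct G X →L[ℂ] ℂ :=
  regularCoeff (evalRep.{v, max u v} x) g h unitVector unitVector

open Classical in
theorem entry_ofFun_mul_u (x : X) (g h : G) (f : C(X, ℂ)) (s : G) :
    entry x g h (ofFun G X f * u G X s) = if g = s * h then f (g • x) else 0 := by
  rw [entry, regularCoeff_ofFun_mul_u]
  refine if_congr Iff.rfl ?_ rfl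
  change inner ℂ unitVector (f (g⁻¹⁻¹ • x) • unitVector) = _
  rw [inner_smul_right, inner_unitVector_unitVector, inv_inv, mul_one]

open Classical in
theorem entry_ofFun (x : X) (g h : G) (f : C(X, ℂ)) :
    entry x g h (ofFun G X f) = if g = h then f (g • x) else 0 := by
  have := entry_ofFun_mul_u x g h f 1
  rwa [u_one, mul_one, one_mul] at this

theorem norm_entry_le (x : X) (g h : G) (a : CrossedProduct G X) : ‖entry x g h a‖ ≤ ‖a‖ := by
  refine (norm_coeff_le _ _ _ a).trans_eq ?_
  rw [norm_regularSingle, norm_regularSingle, norm_unitVector, one_mul, mul_one]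

theorem entry_star (x : X) (g h : G) (a : CrossedProduct G X) :
    entry x g h (star a) = star (entry x h g a) := by
  rw [entry, entry, regularCoeff_apply, regularCoeff_apply, map_star,
    ContinuousLinearMap.star_eq_adjoint, ContinuousLinearMap.adjoint_inner_right]
  exact (inner_conj_symm _ _).symm

theorem hasSum_entry (x : X) (k : G) (a : CrossedProduct G X) :
    HasSum (fun h => entry x h k a • regularSingle (evalRep.{v, max u v} x) h unitVector)
      (rep (regularRep G (evalRep.{v, max u v} x)) a (regularSingle (evalRep.{v, max u v} x) k unitVector)) := by
  classical
  have h := hasSum_regularSingle (evalRep.{v, max u v} x)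
    (rep (regularRep G (evalRep.{v, max u v} x)) a (regularSingle (evalRep.{v, max u v} x) k unitVector))
  refine h.congr_fun fun h => ?_
  rw [entry, regularCoeff_apply, inner_regularSingle, ← regularSingle_smul,
    inner_unitVector_smul]

/-- Matrix multiplication: expand `b δ_k` in the basis `δ_h` and pair with `a^* δ_g`. -/
theorem hasSum_entry_mul (x : X) (g k : G) (a b : CrossedProduct G X) :
    HasSum (fun h => entry x g h a * entry x h k b) (entry x g k (a * b)) := by
  have h1 : entry x g k (a * b) = innerSL ℂ (rep (regularRep G (evalRep.{v, max u v} x)) (star a)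
      (regularSingle (evalRep.{v, max u v} x) g unitVector))
      (rep (regularRep G (evalRep.{v, max u v} x)) b (regularSingle (evalRep.{v, max u v} x) k unitVector)) := by
    rw [innerSL_apply_apply, map_star, ContinuousLinearMap.star_eq_adjoint,
      ContinuousLinearMap.adjoint_inner_left, entry, regularCoeff_apply, map_mul]
    rfl
  rw [h1]
  refine ((hasSum_entry x k b).mapL _).congr_fun fun h => ?_
  rw [map_smul, innerSL_apply_apply, smul_eq_mul, mul_comm, map_star,
      ContinuousLinearMap.star_eq_adjoint, ContinuousLinearMap.adjoint_inner_left]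
  rfl

/-- Moving the base point along its orbit translates both indices on the right. Hence column `1` at
all points carries every entry. -/
theorem entry_smul (x : X) (g h k : G) (a : CrossedProduct G X) :
    entry (k • x) g h a = entry x (g * k) (h * k) a := by
  classical
  refine DFunLike.congr_fun (continuousLinearMap_ext (S := entry (k • x) g h)
    (T := entry x (g * k) (h * k)) fun f s => ?_) a
  rw [entry_ofFun_mul_u, entry_ofFun_mul_u, mul_smul]
  simp [← mul_assoc]

/-- Clear for finite combinations of the `f u_s`; in general a uniform limit of these, as
`norm_entry_le` is uniform in `x`. -/
theorem continuous_entry (g h : G) (a : CrossedProduct G X) :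
    Continuous fun x : X => entry x g h a := by
  classical
  refine continuous_of_uniform_approx_of_continuous fun s hs => ?_
  obtain ⟨ε, hε, hs⟩ := Metric.mem_uniformity_dist.1 hs
  obtain ⟨b, hb, hab⟩ := Metric.mem_closure_iff.1 (dense_algebraicSpan a) ε hε
  refine ⟨fun x => entry x g h b, ?_, fun x => hs ?_⟩
  · clear hab
    induction hb using Submodule.span_induction with
    | mem b hb =>
      obtain ⟨⟨f, s⟩, rfl⟩ := hb
      simp only [entry_ofFun_mul_u]
      split_ifs
      · exact f.continuous.comp (continuous_const_smul g)
      · exact continuous_const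
    | zero => simpa using continuous_const
    | add b b' _ _ hb hb' => simp only [map_add]; exact hb.add hb'
    | smul c b _ hb => simp only [map_smul]; exact hb.const_smul c
  · rw [dist_eq_norm, ← map_sub]
    exact (norm_entry_le _ _ _ _).trans_lt (by rwa [← dist_eq_norm])

/-- The matrix entries as continuous functions on `X`. -/
def entryFun (g h : G) : CrossedProduct G X →L[ℂ] C(X, ℂ) :=
  LinearMap.mkContinuous
    { toFun := fun a => ⟨fun x => entry x g h a, continuous_entry g h a⟩
      map_add' := fun a b => by ext x; exact map_add (entry x g h) a b
      map_smul' := fun c a => by ext x; exact map_smul (entry x g h) c a } 1 fun a => by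
    rw [one_mul]
    exact (ContinuousMap.norm_le _ (norm_nonneg _)).2 fun x => norm_entry_le x g h a

theorem entryFun_apply (g h : G) (a : CrossedProduct G X) (x : X) :
    entryFun g h a x = entry x g h a := rfl

/-- Reduces every regular representation to the orbit representations, so that elements with zero
entries have zero coefficients in all of them. -/
theorem regularCoeff_eq {K : Type (max u v)} [NormedAddCommGroup K] [InnerProductSpace ℂ K]
    [CompleteSpace K] [Nontrivial K] (π : C(X, ℂ) →⋆ₐ[ℂ] (K →L[ℂ] K)) (g h : G) (ξ η : K)
    (a : CrossedProduct G X) :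
    regularCoeff π g h ξ η a = inner ℂ ξ (π (entryFun g h a) η) := by
  classical
  let πL : C(X, ℂ) →L[ℂ] (K →L[ℂ] K) :=
    LinearMap.mkContinuous π.toAlgHom.toLinearMap 1 fun f => by
      rw [one_mul]; exact NonUnitalStarAlgHom.norm_apply_le π f
  let T : CrossedProduct G X →L[ℂ] ℂ :=
    (innerSL ℂ ξ).comp (((ContinuousLinearMap.apply ℂ K η).comp πL).comp (entryFun g h))
  refine DFunLike.congr_fun (continuousLinearMap_ext (S := regularCoeff π g h ξ η)
    (T := T) fun f s => ?_) a
  change _ = inner ℂ ξ (π (entryFun g h _) η)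
  rw [regularCoeff_ofFun_mul_u]
  have h1 : entryFun g h (ofFun G X f * u G X s) =
      if g = s * h then translateFun g⁻¹ f else 0 := by
    ext x
    rw [entryFun_apply, entry_ofFun_mul_u]
    split_ifs
    · rw [translateFun_apply, inv_inv]
    · rfl
  rw [h1]
  split_ifs
  · rfl
  · rw [map_zero]; simp

end Entry

/-! ### Amenability: the entries determine the element. -/

section Amenable

variable {G : Type u} {X : Type v} [Group G] [TopologicalSpace X] [CompactSpace X]
  [MulAction G X] [ContinuousConstSMul G X]

/-- The vector `(U_h^* ξ)_{h ∈ F}` of `ℓ²(G, H)`. -/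
def spread (ρ : CovariantRep.{u, v} G X) (F : Finset G) (ξ : ρ.H) : (regularRep G ρ.π).H :=
  ∑ h ∈ F, regularSingle ρ.π h ((ρ.U h⁻¹ : ρ.H →L[ℂ] ρ.H) ξ)

theorem norm_spread (ρ : CovariantRep.{u, v} G X) (F : Finset G) (ξ : ρ.H) :
    ‖spread ρ F ξ‖ = √(F.card) * ‖ξ‖ := by
  classical
  have h : ‖spread ρ F ξ‖ ^ (2 : ℝ≥0∞).toReal = _ :=
    lp.norm_sum_single (E := fun _ : G => ρ.H) (p := 2) (by norm_num)
      (fun h => (ρ.U h⁻¹ : ρ.H →L[ℂ] ρ.H) ξ) F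
  simp only [Unitary.norm_map, Finset.sum_const, nsmul_eq_mul] at h
  norm_num at h
  rw [← Real.sqrt_sq (norm_nonneg (spread ρ F ξ)), h, Real.sqrt_mul (by positivity),
    Real.sqrt_sq (norm_nonneg _)]

theorem coeff_spread (ρ : CovariantRep.{u, v} G X) (F : Finset G) (ξ η : ρ.H)
    (a : CrossedProduct G X) :
    coeff (regularRep G ρ.π) (spread ρ F ξ) (spread ρ F η) a =
      ∑ g ∈ F, ∑ h ∈ F, regularCoeff ρ.π g h ((ρ.U g⁻¹ : ρ.H →L[ℂ] ρ.H) ξ)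
        ((ρ.U h⁻¹ : ρ.H →L[ℂ] ρ.H) η) a := by
  simp only [coeff_apply, spread, sum_inner, map_sum, inner_sum, regularCoeff_apply]
  exact Finset.sum_comm

-- By covariance the twist by `U_h^*` turns each nonzero term into the same coefficient of `ρ`; the
-- number of such terms is `|F ∩ sF|`.
open Classical in
theorem coeff_spread_ofFun_mul_u (ρ : CovariantRep.{u, v} G X) (F : Finset G) (ξ η : ρ.H)
    (f : C(X, ℂ)) (s : G) :
    coeff (regularRep G ρ.π) (spread ρ F ξ) (spread ρ F η) (ofFun G X f * u G X s) =
      ({g ∈ F | s⁻¹ * g ∈ F}.card : ℂ) * coeff ρ ξ η (ofFun G X f * u G X s) := by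
  have h1 : ∀ g h : G, regularCoeff ρ.π g h ((ρ.U g⁻¹ : ρ.H →L[ℂ] ρ.H) ξ)
      ((ρ.U h⁻¹ : ρ.H →L[ℂ] ρ.H) η) (ofFun G X f * u G X s) =
      if s⁻¹ * g = h then coeff ρ ξ η (ofFun G X f * u G X s) else 0 := by
    intro g h
    rw [regularCoeff_ofFun_mul_u]
    split_ifs with H H' H'
    · have h2 : star (ρ.U g⁻¹ : ρ.H →L[ℂ] ρ.H) * ρ.U h⁻¹ = ρ.U s := by
        rw [← Unitary.coe_star, Unitary.star_eq_inv, ← map_inv, ← Submonoid.coe_mul, ← map_mul]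
        congr 2
        rw [H]
        group
      rw [← ρ.covariant, coeff_apply, map_mul, rep_ofFun, rep_u, ← h2]
      exact Unitary.inner_map_map _ _ _
    · exact absurd (by rw [H]; group) H'
    · exact absurd (by rw [← H']; group) H
    · rfl
  simp only [coeff_spread, h1, Finset.sum_ite_eq]
  rw [← Finset.sum_filter, Finset.sum_const, nsmul_eq_mul]

end Amenable

end CrossedProduct

open Classical in
theorem IsAmenableGroup.exists_seq {G : Type u} [Group G] [Countable G] (hG : IsAmenableGroup G) :
    ∃ F : ℕ → Finset G, (∀ n, (F n).Nonempty) ∧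
      ∀ s : G, Tendsto (fun n => ({g ∈ F n | s⁻¹ * g ∈ F n}.card : ℝ) / (F n).card)
        atTop (𝓝 1) := by
  obtain ⟨e, he⟩ := exists_surjective_nat G
  have h1 : ∀ n : ℕ, ∃ F : Finset G, F.Nonempty ∧ ∀ k ≤ n,
      ((symmDiff (e k • (F : Set G)) F).ncard : ℝ) ≤ 1 / ((n : ℝ) + 1) * F.card := by
    intro n
    obtain ⟨F, hF, hne, h⟩ := hG (e '' Set.Iic n) ((Set.finite_Iic n).image e) (1 / ((n : ℝ) + 1))
      (by positivity)
    refine ⟨hF.toFinset, by simpa using hne, fun k hk => ?_⟩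
    rw [hF.coe_toFinset, ← Set.ncard_eq_toFinset_card F hF]
    exact h _ ⟨k, hk, rfl⟩
  choose F hne hF using h1
  refine ⟨F, hne, fun s => ?_⟩
  obtain ⟨k, rfl⟩ := he s
  have hlow : ∀ᶠ n : ℕ in atTop, 1 - 1 / ((n : ℝ) + 1) ≤
      ({g ∈ F n | (e k)⁻¹ * g ∈ F n}.card : ℝ) / (F n).card := by
    filter_upwards [eventually_ge_atTop k] with n hn
    have hpos : (0 : ℝ) < (F n).card := by exact_mod_cast (hne n).card_pos
    rw [le_div_iff₀ hpos]
    have h2 := hF n k hn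
    have h3 : ({g ∈ F n | ¬ (e k)⁻¹ * g ∈ F n}.card : ℝ) ≤
        (symmDiff (e k • (F n : Set G)) (F n)).ncard := by
      rw [← Set.ncard_coe_finset]
      have hfin : (symmDiff (e k • (F n : Set G)) (F n)).Finite :=
        ((F n).finite_toSet.smul_set.union (F n).finite_toSet).subset symmDiff_le_sup
      refine Nat.cast_le.2 (Set.ncard_le_ncard (fun g hg => ?_) hfin)
      rw [Finset.mem_coe, Finset.mem_filter] at hg
      refine Or.inr ⟨hg.1, fun h => hg.2 ?_⟩
      rwa [Set.mem_smul_set_iff_inv_smul_mem] at h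
    have h4 : ({g ∈ F n | (e k)⁻¹ * g ∈ F n}.card : ℝ) +
        {g ∈ F n | ¬ (e k)⁻¹ * g ∈ F n}.card = (F n).card := by
      exact_mod_cast Finset.card_filter_add_card_filter_not _
    linarith
  refine tendsto_of_tendsto_of_tendsto_of_le_of_le' ?_ tendsto_const_nhds hlow ?_
  · simpa using (tendsto_const_nhds (x := (1 : ℝ))).sub tendsto_one_div_add_atTop_nhds_zero_nat
  · exact Eventually.of_forall fun n => div_le_one_of_le₀
      (by exact_mod_cast Finset.card_filter_le _ _) (by positivity)

namespace CrossedProduct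

section Faithful

variable {G : Type u} {X : Type v} [Group G] [TopologicalSpace X] [CompactSpace X]
  [MulAction G X] [ContinuousConstSMul G X]

/-- The coefficients of `ρ` are the limits of those of the regular representation along a Følner
sequence, on the algebraic crossed product. -/
theorem tendsto_coeff_spread {F : ℕ → Finset G}
    (hF : open Classical in
      ∀ s : G, Tendsto (fun n => ({g ∈ F n | s⁻¹ * g ∈ F n}.card : ℝ) / (F n).card)
        atTop (𝓝 1))
    (ρ : CovariantRep.{u, v} G X) (ξ η : ρ.H) {b : CrossedProduct G X}
    (hb : b ∈ algebraicSpan G X) :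
    Tendsto (fun n => ((F n).card : ℂ)⁻¹ *
      coeff (regularRep G ρ.π) (spread ρ (F n) ξ) (spread ρ (F n) η) b) atTop
      (𝓝 (coeff ρ ξ η b)) := by
  classical
  induction hb using Submodule.span_induction with
  | mem b hb =>
    obtain ⟨⟨f, s⟩, rfl⟩ := hb
    have h1 := ((Complex.continuous_ofReal.tendsto _).comp (hF s)).mul_const
      (coeff ρ ξ η (ofFun G X f * u G X s))
    simp only [Complex.ofReal_one, one_mul] at h1
    refine h1.congr fun n => ?_
    simp only [coeff_spread_ofFun_mul_u, Function.comp_apply]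
    push_cast
    ring_nf
  | zero => simp
  | add b b' _ _ hb hb' => simpa only [map_add, mul_add] using hb.add hb'
  | smul c b _ hb => simpa only [map_smul, smul_eq_mul, mul_left_comm] using hb.const_mul c

/-- Amenability of `G` makes the regular representations faithful: an element of the crossed product
is determined by its Fourier coefficients. -/
theorem eq_zero_of_entry_eq_zero [Countable G] (hG : IsAmenableGroup G) {a : CrossedProduct G X}
    (ha : ∀ (x : X) (g : G), entry x g 1 a = 0) : a = 0 := by
  obtain ⟨F, hne, hF⟩ := hG.exists_seq
  refine ext_rep fun ρ => ?_
  have h1 : ∀ g h : G, entryFun g h a = 0 := fun g h => by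
    ext x
    have := ha (h • x) (g * h⁻¹)
    rwa [entry_smul, one_mul, inv_mul_cancel_right] at this
  have h2 : ∀ n (ξ η : ρ.H),
      coeff (regularRep G ρ.π) (spread ρ (F n) ξ) (spread ρ (F n) η) a = 0 := by
    intro n ξ η
    rw [coeff_spread]
    refine Finset.sum_eq_zero fun g _ => Finset.sum_eq_zero fun h _ => ?_
    rw [regularCoeff_eq, h1, map_zero]
    simp
  have h3 : ∀ ξ η : ρ.H, coeff ρ ξ η a = 0 := by
    intro ξ η
    -- The spread coefficients of `a` vanish, so those of `b` are, up to sign, those of `a - b`.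
    -- After division by `|F_n|` they are bounded independently of `n`, and they converge to the
    -- coefficient of `b` in `ρ`.
    have h4 : ∀ b ∈ algebraicSpan G X, ‖coeff ρ ξ η b‖ ≤ ‖a - b‖ * (‖ξ‖ * ‖η‖) := by
      intro b hb
      refine le_of_tendsto (tendsto_coeff_spread hF ρ ξ η hb).norm
        (Eventually.of_forall fun n => ?_)
      have hpos : (0 : ℝ) < (F n).card := by exact_mod_cast (hne n).card_pos
      have h5 := norm_coeff_le (regularRep G ρ.π) (spread ρ (F n) ξ) (spread ρ (F n) η) (a - b)
      rw [map_sub, h2, zero_sub, norm_neg, norm_spread, norm_spread] at h5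
      rw [norm_mul, norm_inv, Complex.norm_natCast, inv_mul_le_iff₀ hpos]
      refine h5.trans_eq ?_
      have := Real.mul_self_sqrt hpos.le
      linear_combination ‖a - b‖ * ‖ξ‖ * ‖η‖ * this
    obtain ⟨b, hb, hlim⟩ := mem_closure_iff_seq_limit.1 (dense_algebraicSpan a)
    have h5 : Tendsto (fun n => ‖a - b n‖ * (‖ξ‖ * ‖η‖)) atTop (𝓝 0) := by
      simpa using ((tendsto_const_nhds (x := a)).sub hlim).norm.mul_const (‖ξ‖ * ‖η‖)
    have h6 := squeeze_zero_norm (fun n => h4 (b n) (hb n)) h5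
    exact tendsto_nhds_unique (((coeff ρ ξ η).continuous.tendsto a).comp hlim) h6
  ext η
  refine ext_inner_left ℂ fun ξ => ?_
  rw [map_zero, zero_apply, inner_zero_right]
  exact h3 ξ η

end Faithful

end CrossedProduct

/-! ### Normalizers of `C(X)` under a free action. -/

/-- On a free orbit, an absolutely summable combination of point evaluations vanishes only if its
coefficients do. -/
theorem eq_zero_of_hasSum_mul_apply_smul {G : Type u} {X : Type v} [Group G] [TopologicalSpace X]
    [CompactSpace X] [T2Space X] [MulAction G X]
    (hfree : ∀ (g : G) (x : X), g • x = x → g = 1) {x : X} {c : G → ℂ}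
    (hc : ∀ d : C(X, ℂ), HasSum (fun g => c g * d (g • x)) 0) (g₀ : G) : c g₀ = 0 := by
  classical
  have hinj : Function.Injective fun g : G => g • x := by
    intro g h hgh
    have : (h⁻¹ * g) • x = x := by
      rw [mul_smul]; exact inv_smul_eq_iff.2 hgh
    exact (inv_mul_eq_one.1 (hfree _ _ this)).symm
  have hsum : Summable fun g => ‖c g‖ := by
    simpa using (hc 1).summable.norm
  rw [← norm_le_zero_iff]
  refine le_of_forall_pos_le_add fun ε hε => ?_
  obtain ⟨s, hs⟩ := (summable_iff_vanishing_norm.1 hsum) ε hε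
  have hdisj : Disjoint ((fun g : G => g • x) '' (s.erase g₀ : Set G)) {g₀ • x} := by
    rw [Set.disjoint_singleton_right]
    rintro ⟨g, hg, hgx⟩
    have : g = g₀ := hinj hgx
    simp [this] at hg
  -- The test function isolates `g₀ x` from the other orbit points indexed by `s`; the points
  -- outside `s` carry coefficients of total mass below `ε`.
  obtain ⟨d, hd0, hd1, hd⟩ := exists_continuous_zero_one_of_isClosed
    ((s.erase g₀).finite_toSet.image fun g : G => g • x).isClosed isClosed_singleton hdisj
  have h1 := hc ⟨fun y => (d y : ℂ), by fun_prop⟩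
  simp only [ContinuousMap.coe_mk] at h1
  have h2 : ∀ t : Finset G, s ∪ {g₀} ⊆ t →
      ‖∑ g ∈ t, c g * (d (g • x) : ℂ) - c g₀‖ ≤ ε := by
    intro t ht
    have hg₀ : g₀ ∈ t := ht (by simp)
    rw [← Finset.add_sum_erase t _ hg₀, hd1 rfl]
    simp only [Pi.one_apply, Complex.ofReal_one, mul_one, add_sub_cancel_left]
    have h3 : ∑ g ∈ t.erase g₀, c g * (d (g • x) : ℂ) =
        ∑ g ∈ (t.erase g₀) \ s, c g * (d (g • x) : ℂ) := by
      refine (Finset.sum_subset Finset.sdiff_subset fun g hg hg' => ?_).symm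
      have hgs : g ∈ s.erase g₀ := by
        simp only [Finset.mem_sdiff, not_and, not_not] at hg'
        exact Finset.mem_erase.2 ⟨(Finset.mem_erase.1 hg).1, hg' hg⟩
      rw [hd0 ⟨g, by exact_mod_cast hgs, rfl⟩]
      simp
    rw [h3]
    refine (norm_sum_le _ _).trans (le_trans (Finset.sum_le_sum fun g _ => ?_)
      ((Real.le_norm_self _).trans (hs _ Finset.sdiff_disjoint).le))
    rw [norm_mul, Complex.norm_real, Real.norm_of_nonneg (hd _).1]
    exact mul_le_of_le_one_right (norm_nonneg _) (hd _).2
  have h3 : ‖(0 : ℂ) - c g₀‖ ≤ ε :=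
    le_of_tendsto (h1.sub_const (c g₀)).norm (eventually_atTop.2 ⟨s ∪ {g₀}, h2⟩)
  simpa using h3

namespace CrossedProduct

section Normalizer

variable {G : Type u} {X : Type v} [Group G] [TopologicalSpace X] [CompactSpace X]
  [MulAction G X] [ContinuousConstSMul G X]

theorem entry_mul_ofFun (x : X) (g h : G) (a : CrossedProduct G X) (d : C(X, ℂ)) :
    entry x g h (a * ofFun G X d) = entry x g h a * d (h • x) := by
  classical
  refine (hasSum_entry_mul x g h a (ofFun G X d)).unique ?_
  convert hasSum_single h fun k hk => ?_ using 1
  · rw [entry_ofFun, if_pos rfl]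
  · rw [entry_ofFun, if_neg hk, mul_zero]

variable [T2Space X]

/-- Each row of the matrix of a normalizer has at most one nonzero entry. -/
theorem entry_mul_entry_eq_zero_of_row (hfree : ∀ (g : G) (x : X), g • x = x → g = 1)
    {v : CrossedProduct G X} (hv : v ∈ normalizers (base G X)) (x : X) (g : G) {h k : G}
    (hhk : h ≠ k) : entry x g h v * entry x g k v = 0 := by
  classical
  -- `v^* d v` lies in `C(X)`, so its off-diagonal entry `∑_g conj(v_gh) v_gk d(g x)` vanishes for
  -- every `d`, and therefore so does each coefficient.
  have h1 := eq_zero_of_hasSum_mul_apply_smul hfree (x := x)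
    (c := fun g => star (entry x g h v) * entry x g k v) (fun d => by
      obtain ⟨c, hc⟩ := (hv (ofFun G X d) ⟨d, rfl⟩).1
      have h2 := hasSum_entry_mul x h k (star v * ofFun G X d) v
      have h3 : entry x h k (star v * ofFun G X d * v) = 0 := by
        rw [← hc]
        exact (entry_ofFun x h k c).trans (if_neg hhk)
      rw [h3] at h2
      refine h2.congr_fun fun g => ?_
      rw [entry_mul_ofFun, entry_star]
      ring) g
  simpa using h1

/-- Each column of the matrix of a normalizer has at most one nonzero entry. -/
theorem entry_mul_entry_eq_zero_of_column (hfree : ∀ (g : G) (x : X), g • x = x → g = 1)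
    {v : CrossedProduct G X} (hv : v ∈ normalizers (base G X)) (x : X) (k : G) {g h : G}
    (hgh : g ≠ h) : entry x g k v * entry x h k v = 0 := by
  have hv' : star v ∈ normalizers (base G X) := fun d hd => by
    rw [star_star]; exact (hv d hd).symm
  have h1 := entry_mul_entry_eq_zero_of_row hfree hv' x k hgh
  rw [entry_star, entry_star] at h1
  simpa using h1

end Normalizer

section Positive

variable {G : Type u} {X : Type v} [Group G] [TopologicalSpace X] [CompactSpace X]
  [MulAction G X] [ContinuousConstSMul G X]

/-- A real function as an element of `C(X)`. -/
def ofRealFun (e : C(X, ℝ)) : C(X, ℂ) := ⟨fun x => (e x : ℂ), by fun_prop⟩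

theorem ofFun_ofRealFun_nonneg {e : C(X, ℝ)} (he : 0 ≤ e) : 0 ≤ ofFun G X (ofRealFun e) := by
  let r : C(X, ℝ) := ⟨fun x => √(e x), by fun_prop⟩
  have h : ofFun G X (ofRealFun e) = star (ofFun G X (ofRealFun r)) * ofFun G X (ofRealFun r) := by
    rw [← map_star, ← map_mul]
    congr 1
    ext x
    change (e x : ℂ) = star (√(e x) : ℂ) * (√(e x) : ℂ)
    rw [Complex.star_def, Complex.conj_ofReal, ← Complex.ofReal_mul, Real.mul_self_sqrt (show 0 ≤ e x from he x)]
  rw [h]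
  exact star_mul_self_nonneg _

theorem entry_star_mul_self (x : X) (g : G) (a : CrossedProduct G X) :
    ∃ r : ℝ, 0 ≤ r ∧ entry x g g (star a * a) = r := by
  refine ⟨_, sq_nonneg ‖rep (regularRep G (evalRep.{v, max u v} x)) a
    (regularSingle (evalRep.{v, max u v} x) g unitVector)‖, ?_⟩
  rw [entry, regularCoeff_apply, map_mul, map_star, mul_apply_eq_comp,
    ContinuousLinearMap.star_eq_adjoint, ContinuousLinearMap.adjoint_inner_right,
    inner_self_eq_norm_sq_to_K]
  simp

/-- A positive normalizer of `C(X)` belongs to `C(X)`. -/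
theorem exists_eq_ofFun_of_nonneg {a : CrossedProduct G X} (ha : 0 ≤ a)
    (hn : a ∈ normalizers (base G X)) : ∃ e : C(X, ℝ), 0 ≤ e ∧ a = ofFun G X (ofRealFun e) := by
  -- Normalizing `1` puts `a^* a = a²` in `C(X)`; uniqueness of positive square roots then puts `a`
  -- there.
  obtain ⟨c, hc⟩ := (hn 1 (one_mem _)).1
  rw [mul_one] at hc
  change ofFun G X c = _ at hc
  have hre : ∀ x, 0 ≤ (c x).re ∧ ((c x).re : ℂ) = c x := by
    intro x
    obtain ⟨r, hr, h⟩ := entry_star_mul_self x (1 : G) a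
    rw [← hc, entry_ofFun, if_pos rfl, one_smul] at h
    rw [h]
    exact ⟨by simpa using hr, by simp⟩
  let e : C(X, ℝ) := ⟨fun x => √((c x).re), by fun_prop⟩
  have he : 0 ≤ e := fun x => Real.sqrt_nonneg _
  refine ⟨e, he, ?_⟩
  have h1 : ofFun G X (ofRealFun e) * ofFun G X (ofRealFun e) = a * a := by
    rw [(IsSelfAdjoint.of_nonneg ha).star_eq] at hc
    rw [← hc, ← map_mul]
    congr 1
    ext x
    change (√((c x).re) : ℂ) * (√((c x).re) : ℂ) = c x
    rw [← Complex.ofReal_mul, Real.mul_self_sqrt (hre x).1, (hre x).2]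
  rw [← CFC.sqrt_mul_self a ha, ← h1, CFC.sqrt_mul_self _ (ofFun_ofRealFun_nonneg he)]

end Positive

end CrossedProduct

/-! ### Towers built from the nonzero entries. -/

/-- A system of normalizers of `C(X)` in the crossed product of a free action, satisfying the relations of the images
of the matrix units under an order zero map. -/
structure NormalizerSystem (G : Type u) (X : Type v) [Group G] [TopologicalSpace X]
    [CompactSpace X] [MulAction G X] [ContinuousConstSMul G X] (n : ℕ) where
  free : ∀ (g : G) (x : X), g • x = x → g = 1
  E : Fin n → Fin n → CrossedProduct G X
  e : Fin n → C(X, ℝ)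
  e_nonneg : ∀ i, 0 ≤ e i
  E_self : ∀ i, E i i = CrossedProduct.ofFun G X (CrossedProduct.ofRealFun (e i))
  star_E : ∀ i j, star (E i j) = E j i
  E_mul_of_ne : ∀ i j k l, j ≠ k → E i j * E k l = 0
  E_mul : ∀ i j k l, E i j * E j l = E i k * E k l
  mem_normalizers : ∀ i j, E i j ∈ normalizers (CrossedProduct.base G X)

theorem IsCPCOrderZero.exists_normalizerSystem {G : Type u} {X : Type v} [Group G]
    [TopologicalSpace X] [CompactSpace X] [MulAction G X] [ContinuousConstSMul G X] {n : ℕ}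
    (hfree : ∀ (g : G) (x : X), g • x = x → g = 1)
    {φ : CStarMatrix (Fin n) (Fin n) ℂ →ₗ[ℂ] CrossedProduct G X} (hφ : IsCPCOrderZero φ)
    (hnorm : ∀ a ∈ normalizers (diagonalMatrices n),
      φ a ∈ normalizers (CrossedProduct.base G X)) :
    ∃ S : NormalizerSystem G X n, ∀ i j, S.E i j = φ (matrixUnit i j) := by
  have hmem := fun i j : Fin n => hnorm _ (matrixUnit_mem_normalizers i j)
  choose e he0 he using fun i => CrossedProduct.exists_eq_ofFun_of_nonneg
    (hφ.map_matrixUnit_self_nonneg i) (hmem i i)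
  exact ⟨⟨hfree, fun i j => φ (matrixUnit i j), e, he0, he, hφ.star_map_matrixUnit,
    fun i j k l h => hφ.map_matrixUnit_mul_of_ne i l h, hφ.map_matrixUnit_mul, hmem⟩,
    fun _ _ => rfl⟩

namespace NormalizerSystem

open CrossedProduct

variable {G : Type u} {X : Type v} [Group G] [TopologicalSpace X] [CompactSpace X]
  [MulAction G X] [ContinuousConstSMul G X] {n : ℕ} (S : NormalizerSystem G X n)

theorem entry_E_mul_E_self (x : X) (g h : G) (i j : Fin n) :
    entry x g h (S.E i j * S.E j j) = entry x g h (S.E i j) * S.e j (h • x) := by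
  rw [S.E_self j, entry_mul_ofFun]
  rfl

open Classical in
theorem entry_E_self (x : X) (g h : G) (i : Fin n) :
    entry x g h (S.E i i) = if g = h then (S.e i (h • x) : ℂ) else 0 := by
  rw [S.E_self, entry_ofFun]
  split_ifs with H
  · rw [H]; rfl
  · rfl

theorem e_mul_e {i j : Fin n} (hij : i ≠ j) (x : X) : S.e i x * S.e j x = 0 := by
  have h := congrArg (entry x (1 : G) 1) (S.E_mul_of_ne i i j j hij)
  rw [S.E_self j, entry_mul_ofFun, entry_E_self, if_pos rfl, map_zero, one_smul] at h
  change (S.e i x : ℂ) * (S.e j x : ℂ) = 0 at h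
  exact_mod_cast h

/-- This is the diagonal entry of `E_ij^* E_ij = E_ji E_ij = E_jj E_jj = e_j²`. -/
theorem hasSum_normSq_entry (x : X) (h : G) (i j : Fin n) :
    HasSum (fun g => (‖entry x g h (S.E i j)‖ : ℂ) ^ 2) ((S.e j (h • x) : ℂ) ^ 2) := by
  have h1 := hasSum_entry_mul x h h (S.E j i) (S.E i j)
  rw [S.E_mul j i j j, entry_E_mul_E_self, entry_E_self, if_pos rfl, ← sq] at h1
  refine h1.congr_fun fun g => ?_
  rw [← S.star_E i j, entry_star, Complex.star_def, Complex.conj_mul']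

theorem entry_E_swap (x : X) (g h : G) (i j : Fin n) :
    entry x g h (S.E i j) = star (entry x h g (S.E j i)) := by
  rw [← entry_star, S.star_E]

theorem exists_entry_ne_zero {x : X} {h : G} (i : Fin n) {j : Fin n} (hx : S.e j (h • x) ≠ 0) :
    ∃ g, entry x g h (S.E i j) ≠ 0 := by
  by_contra! H
  have h1 := S.hasSum_normSq_entry x h i j
  simp only [H, norm_zero, Complex.ofReal_zero, zero_pow two_ne_zero] at h1
  have h2 := h1.unique hasSum_zero
  exact hx (by exact_mod_cast pow_eq_zero_iff (two_ne_zero) |>.1 h2)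

/-- The shapes of the towers of the castle. -/
def Shape (i₀ : Fin n) : Type u :=
  {t : Fin n → G // ∃ x : X, ∀ i, entry x (t i) 1 (S.E i i₀) ≠ 0}

/-- The function on the base of the tower of a given shape. -/
def towerFun (i₀ : Fin n) (t : S.Shape i₀) : C(X, ℝ) :=
  Finset.univ.inf' ⟨i₀, Finset.mem_univ _⟩ fun i =>
    (⟨fun x => ‖entry x (t.1 i) 1 (S.E i i₀)‖, (continuous_entry _ _ _).norm⟩ : C(X, ℝ))

theorem towerFun_apply (i₀ : Fin n) (t : S.Shape i₀) (x : X) :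
    S.towerFun i₀ t x = Finset.univ.inf' ⟨i₀, Finset.mem_univ _⟩
      fun i => ‖entry x (t.1 i) 1 (S.E i i₀)‖ := by
  exact ContinuousMap.inf'_apply _ _ _

theorem towerFun_nonneg (i₀ : Fin n) (t : S.Shape i₀) : 0 ≤ S.towerFun i₀ t := fun x => by
  change 0 ≤ S.towerFun i₀ t x
  rw [towerFun_apply]
  exact Finset.le_inf' _ _ fun i _ => norm_nonneg _

theorem entry_ne_zero {i₀ : Fin n} {t : S.Shape i₀} {x : X} (hx : S.towerFun i₀ t x ≠ 0)
    (i : Fin n) : entry x (t.1 i) 1 (S.E i i₀) ≠ 0 := by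
  intro h
  refine hx (le_antisymm ?_ (S.towerFun_nonneg i₀ t x))
  rw [towerFun_apply]
  exact (Finset.inf'_le _ (Finset.mem_univ i)).trans_eq (by rw [h, norm_zero])

variable [T2Space X]

/-- A column has only one nonzero entry, so its square sum `e_j²` reduces to one term. -/
theorem norm_entry_right {x : X} {g h : G} {i j : Fin n} (hne : entry x g h (S.E i j) ≠ 0) :
    ‖entry x g h (S.E i j)‖ = S.e j (h • x) := by
  have h1 := (S.hasSum_normSq_entry x h i j).unique (hasSum_single g fun g' hg' => by
    have := entry_mul_entry_eq_zero_of_column S.free (S.mem_normalizers i j) x h hg'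
    rw [(mul_eq_zero.1 this).resolve_right hne]
    simp)
  exact ((sq_eq_sq₀ (S.e_nonneg j _) (norm_nonneg _)).1 (by exact_mod_cast h1)).symm

theorem norm_entry_left {x : X} {g h : G} {i j : Fin n} (hne : entry x g h (S.E i j) ≠ 0) :
    ‖entry x g h (S.E i j)‖ = S.e i (g • x) := by
  rw [S.entry_E_swap, norm_star]
  refine S.norm_entry_right ?_
  rw [S.entry_E_swap] at hne
  exact star_ne_zero.1 hne

/-- The levels through a point are determined by the point. -/
theorem eq_of_smul_eq (i₀ : Fin n) {i j : Fin n} {g h : G} {x y : X}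
    (hx : entry x g 1 (S.E i i₀) ≠ 0) (hy : entry y h 1 (S.E j i₀) ≠ 0) (hxy : g • x = h • y) :
    i = j ∧ g = h ∧ x = y := by
  -- Rebasing at the common point `g x = h y` puts both entries in row `1`, in columns `g⁻¹` and
  -- `h⁻¹`; a row has only one nonzero entry.
  have key : ∀ {i : Fin n} {g : G} {x : X}, entry x g 1 (S.E i i₀) =
      entry (g • x) 1 g⁻¹ (S.E i i₀) := fun {i g x} => by
    rw [entry_smul, one_mul, inv_mul_cancel]
  have hij : i = j := by
    by_contra hij
    have h1 := S.norm_entry_left hx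
    have h2 := S.norm_entry_left hy
    have h3 := S.e_mul_e hij (g • x)
    rw [← h1, hxy, ← h2] at h3
    exact (mul_ne_zero (norm_ne_zero_iff.2 hx) (norm_ne_zero_iff.2 hy)) h3
  subst hij
  have hgh : g = h := by
    by_contra hgh
    rw [key] at hx hy
    rw [← hxy] at hy
    have h1 := entry_mul_entry_eq_zero_of_row S.free (S.mem_normalizers i i₀) (g • x) 1
      (fun h => hgh (inv_injective h))
    exact mul_ne_zero hx hy h1
  subst hgh
  exact ⟨rfl, rfl, smul_left_cancel g hxy⟩

/-- All `n` entries have modulus `e_{i₀}(x)`, so the minimum is their common value. The minimum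
serves to give a continuous function on `X` supported exactly where all of them are nonzero. -/
theorem towerFun_eq_e {i₀ : Fin n} {t : S.Shape i₀} {x : X}
    (hx : ∀ i, entry x (t.1 i) 1 (S.E i i₀) ≠ 0) : S.towerFun i₀ t x = S.e i₀ x := by
  have h1 : ∀ i, ‖entry x (t.1 i) 1 (S.E i i₀)‖ = S.e i₀ x := fun i => by
    rw [S.norm_entry_right (hx i), one_smul]
  rw [towerFun_apply]
  simp only [h1]
  exact Finset.inf'_const _ _

theorem towerFun_ne_zero {i₀ : Fin n} {t : S.Shape i₀} {x : X}
    (hx : ∀ i, entry x (t.1 i) 1 (S.E i i₀) ≠ 0) : S.towerFun i₀ t x ≠ 0 := by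
  rw [S.towerFun_eq_e hx, ← one_smul G x, ← S.norm_entry_right (hx i₀)]
  exact norm_ne_zero_iff.2 (hx i₀)

theorem norm_entry_eq_towerFun {i₀ : Fin n} {t : S.Shape i₀} {x : X}
    (hx : S.towerFun i₀ t x ≠ 0) (i : Fin n) :
    ‖entry x (t.1 i) 1 (S.E i i₀)‖ = S.towerFun i₀ t x := by
  rw [S.norm_entry_right (S.entry_ne_zero hx i), one_smul,
    S.towerFun_eq_e (S.entry_ne_zero hx)]

theorem shape_ext {i₀ : Fin n} {t t' : S.Shape i₀} {x : X} (hx : S.towerFun i₀ t x ≠ 0)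
    (hx' : S.towerFun i₀ t' x ≠ 0) : t = t' := by
  refine Subtype.ext (funext fun i => ?_)
  by_contra hne
  exact mul_ne_zero (S.entry_ne_zero hx i) (S.entry_ne_zero hx' i)
    (entry_mul_entry_eq_zero_of_column S.free (S.mem_normalizers i i₀) x 1 hne)

theorem exists_shape {i₀ : Fin n} {x : X} (hx : S.e i₀ x ≠ 0) :
    ∃ t : S.Shape i₀, S.towerFun i₀ t x ≠ 0 := by
  rw [← one_smul G x] at hx
  choose t ht using fun i => S.exists_entry_ne_zero i hx
  exact ⟨⟨t, x, ht⟩, S.towerFun_ne_zero ht⟩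

theorem shape_eq_of_smul_eq {i₀ : Fin n} {t t' : S.Shape i₀} {i j : Fin n} {x y : X}
    (hx : S.towerFun i₀ t x ≠ 0) (hy : S.towerFun i₀ t' y ≠ 0) (hxy : t.1 i • x = t'.1 j • y) :
    i = j ∧ t = t' ∧ x = y := by
  obtain ⟨rfl, -, rfl⟩ :=
    S.eq_of_smul_eq i₀ (S.entry_ne_zero hx i) (S.entry_ne_zero hy j) hxy
  exact ⟨rfl, S.shape_ext hx hy, rfl⟩

theorem shape_injective {i₀ : Fin n} (t : S.Shape i₀) : Function.Injective t.1 := by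
  intro i j hij
  obtain ⟨x, hx⟩ := t.2
  exact (S.eq_of_smul_eq i₀ (hx i) (hx j) (by rw [hij])).1

theorem isCastle (i₀ : Fin n) :
    IsCastle (fun t : S.Shape i₀ => Function.support (S.towerFun i₀ t))
      (fun t => Set.range t.1) where
  finite_shape t := Set.finite_range _
  disjoint_levels := by
    rintro t t' _ ⟨i, rfl⟩ _ ⟨j, rfl⟩ hne
    rw [Set.disjoint_left]
    rintro _ ⟨x, hx, rfl⟩ ⟨y, hy, hxy⟩
    obtain ⟨rfl, rfl, -⟩ := S.shape_eq_of_smul_eq hx hy hxy.symm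
    exact hne rfl

/-- The disjoint open supports cover the compact set `{e_{i₀} ≥ ε}`, so finitely many suffice. A
tower with `‖f_t‖ ≥ ε` meets this set, hence is one of those. -/
theorem tendsto_norm_towerFun (i₀ : Fin n) :
    Tendsto (fun t => ‖S.towerFun i₀ t‖) cofinite (𝓝 0) := by
  rw [Metric.tendsto_nhds]
  intro ε hε
  have hK : IsCompact {x | ε ≤ S.e i₀ x} :=
    (isClosed_le continuous_const (S.e i₀).continuous).isCompact
  obtain ⟨P, hP⟩ := hK.elim_finite_subcover
    (fun t : S.Shape i₀ => Function.support (S.towerFun i₀ t))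
    (fun t => (S.towerFun i₀ t).continuous.isOpen_support) (fun x hx => by
      obtain ⟨t, ht⟩ := S.exists_shape (hε.trans_le hx).ne'
      exact Set.mem_iUnion.2 ⟨t, ht⟩)
  refine P.finite_toSet.subset fun t ht => ?_
  have ht' : ¬ ‖S.towerFun i₀ t‖ < ε := by simpa using ht
  rw [ContinuousMap.norm_lt_iff _ hε] at ht'
  push Not at ht'
  obtain ⟨x, hx⟩ := ht'
  rw [Real.norm_of_nonneg (show 0 ≤ S.towerFun i₀ t x from S.towerFun_nonneg i₀ t x)] at hx
  have hx0 : S.towerFun i₀ t x ≠ 0 := (hε.trans_le hx).ne'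
  rw [S.towerFun_eq_e (S.entry_ne_zero hx0)] at hx
  obtain ⟨t', ht'P, ht'⟩ := Set.mem_iUnion₂.1 (hP hx)
  rwa [S.shape_ext hx0 ht']

/-- The phases of the castle. -/
def phase (i₀ : Fin n) (t : S.Shape i₀) (i : Fin n) :
    C(Function.support (S.towerFun i₀ t), Circle) where
  toFun x := ⟨entry x.1 (t.1 i) 1 (S.E i i₀) / (‖entry x.1 (t.1 i) 1 (S.E i i₀)‖ : ℂ), by
    have := norm_ne_zero_iff.2 (S.entry_ne_zero x.2 i)
    rw [Submonoid.unitSphere, Submonoid.mem_mk]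
    simp [this]⟩
  continuous_toFun := by
    have hc : Continuous fun x : Function.support (S.towerFun i₀ t) =>
        entry x.1 (t.1 i) 1 (S.E i i₀) := (continuous_entry _ _ _).comp continuous_subtype_val
    exact Continuous.subtype_mk (hc.div (Complex.continuous_ofReal.comp hc.norm) fun x =>
      Complex.ofReal_ne_zero.2 <| norm_ne_zero_iff.2 (S.entry_ne_zero x.2 i)) _

end NormalizerSystem

theorem phaseMul_apply_of_ne_zero {X : Type v} [TopologicalSpace X] {f : C(X, ℝ)}
    (θ : C(Function.support f, Circle)) {x : X} (hx : f x ≠ 0) :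
    phaseMul f θ x = (θ ⟨x, hx⟩ : ℂ) * (f x : ℂ) :=
  dif_pos hx

theorem phaseMul_apply_of_eq_zero {X : Type v} [TopologicalSpace X] {f : C(X, ℝ)}
    (θ : C(Function.support f, Circle)) {x : X} (hx : f x = 0) : phaseMul f θ x = 0 :=
  dif_neg (not_not.2 hx)

theorem norm_phaseMul_apply {X : Type v} [TopologicalSpace X] (f : C(X, ℝ))
    (θ : C(Function.support f, Circle)) (x : X) : ‖phaseMul f θ x‖ = ‖f x‖ := by
  by_cases hx : f x = 0
  · rw [phaseMul_apply_of_eq_zero θ hx, hx, norm_zero, norm_zero]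
  · rw [phaseMul_apply_of_ne_zero θ hx, norm_mul, Circle.norm_coe, one_mul, Complex.norm_real]

/-! ### Norm convergence of the castle sum. -/

namespace CrossedProduct

variable {G : Type u} {X : Type v} [Group G] [TopologicalSpace X] [CompactSpace X]
  [MulAction G X] [ContinuousConstSMul G X]

theorem u_mul_ofFun_mul_star_u (g h : G) (f : C(X, ℂ)) :
    u G X g * ofFun G X f * star (u G X h) = ofFun G X (translateFun g f) * u G X (g * h⁻¹) := by
  rw [u_mul_ofFun, star_u, mul_assoc, ← u_mul]

theorem norm_ofFun_le (f : C(X, ℂ)) : ‖ofFun G X f‖ ≤ ‖f‖ :=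
  NonUnitalStarAlgHom.norm_apply_le (ofFun G X) f

/-- The norm of a finite sum of elements `u_g f u_h^*` with pairwise disjoint sources and pairwise
disjoint ranges. -/
theorem norm_sum_u_mul_ofFun_mul_star_u_le {T : Type*} {g h : T → G} {f : T → C(X, ℂ)}
    (hg : ∀ t t', t ≠ t' → ∀ x y, f t x ≠ 0 → f t' y ≠ 0 → g t • x ≠ g t' • y)
    (hh : ∀ t t', t ≠ t' → ∀ x y, f t x ≠ 0 → f t' y ≠ 0 → h t • x ≠ h t' • y)
    (P : Finset T) {C : ℝ} (hC : 0 ≤ C) (hf : ∀ t ∈ P, ‖f t‖ ≤ C) :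
    ‖∑ t ∈ P, u G X (g t) * ofFun G X (f t) * star (u G X (h t))‖ ≤ C := by
  classical
  set b : T → CrossedProduct G X :=
    fun t => u G X (g t) * ofFun G X (f t) * star (u G X (h t))
  have hstar : ∀ t t', star (b t) * b t' = u G X (h t * (g t)⁻¹) *
      ofFun G X (star (translateFun (g t) (f t)) * translateFun (g t') (f t')) *
      star (u G X (h t' * (g t')⁻¹)) := by
    intro t t'
    rw [show b t = _ from u_mul_ofFun_mul_star_u _ _ _,
      show b t' = _ from u_mul_ofFun_mul_star_u _ _ _]
    simp only [star_mul, star_u, map_mul, map_star, mul_assoc, mul_inv_rev, inv_inv]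
  have hzero : ∀ t t', t ≠ t' → star (b t) * b t' = 0 := by
    intro t t' htt'
    have : star (translateFun (g t) (f t)) * translateFun (g t') (f t') = 0 := by
      ext x
      by_contra hne
      change star (f t ((g t)⁻¹ • x)) * f t' ((g t')⁻¹ • x) ≠ 0 at hne
      exact hg t t' htt' _ _ (star_ne_zero.1 (left_ne_zero_of_mul hne))
        (right_ne_zero_of_mul hne) (by simp)
    rw [hstar, this, map_zero, mul_zero, zero_mul]
  have hself : ∀ t, star (b t) * b t =
      ofFun G X (star (translateFun (h t) (f t)) * translateFun (h t) (f t)) := by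
    intro t
    rw [hstar, u_mul_ofFun_mul_star_u, mul_inv_cancel, u_one, mul_one, ← translateFun_star,
      ← translateFun_star, ← translateFun_mul, ← translateFun_mul, translateFun_translateFun,
      inv_mul_cancel_right]
  -- Disjoint ranges kill the cross terms, leaving a function in `C(X)`; disjoint sources make its
  -- norm a maximum instead of a sum.
  have hsum : star (∑ t ∈ P, b t) * ∑ t ∈ P, b t =
      ofFun G X (∑ t ∈ P, star (translateFun (h t) (f t)) * translateFun (h t) (f t)) := by
    rw [star_sum, Finset.sum_mul_sum, map_sum]
    refine Finset.sum_congr rfl fun t ht => ?_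
    rw [Finset.sum_eq_single t (fun t' _ ht' => hzero t t' ht'.symm) (fun h => absurd ht h),
      hself]
  have hsq : ‖∑ t ∈ P, b t‖ * ‖∑ t ∈ P, b t‖ ≤ C * C := by
    rw [← CStarRing.norm_star_mul_self, hsum]
    refine (norm_ofFun_le _).trans ((ContinuousMap.norm_le _ (by positivity)).2 fun x => ?_)
    rw [ContinuousMap.sum_apply]
    by_cases hx : ∃ t ∈ P, f t ((h t)⁻¹ • x) ≠ 0
    · obtain ⟨t, ht, htx⟩ := hx
      rw [Finset.sum_eq_single t (fun t' _ ht' => ?_) (fun h => absurd ht h)]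
      · change ‖star (f t ((h t)⁻¹ • x)) * f t ((h t)⁻¹ • x)‖ ≤ _
        rw [norm_mul, norm_star]
        have := ((f t).norm_coe_le_norm ((h t)⁻¹ • x)).trans (hf t ht)
        gcongr
      · change star (f t' ((h t')⁻¹ • x)) * f t' ((h t')⁻¹ • x) = 0
        by_contra hne
        exact hh t' t ht' _ _ (right_ne_zero_of_mul hne) htx (by simp)
    · push Not at hx
      rw [Finset.sum_eq_zero fun t ht => ?_, norm_zero]
      · positivity
      · change star (f t ((h t)⁻¹ • x)) * f t ((h t)⁻¹ • x) = 0
        rw [hx t ht, mul_zero]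
  exact abs_le_of_sq_le_sq' (by nlinarith) hC |>.2

theorem summable_u_mul_ofFun_mul_star_u {T : Type*} {g h : T → G} {f : T → C(X, ℂ)}
    (hg : ∀ t t', t ≠ t' → ∀ x y, f t x ≠ 0 → f t' y ≠ 0 → g t • x ≠ g t' • y)
    (hh : ∀ t t', t ≠ t' → ∀ x y, f t x ≠ 0 → f t' y ≠ 0 → h t • x ≠ h t' • y)
    (hf : Tendsto (fun t => ‖f t‖) cofinite (𝓝 0)) :
    Summable fun t => u G X (g t) * ofFun G X (f t) * star (u G X (h t)) := by
  rw [summable_iff_vanishing_norm]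
  intro ε hε
  have h1 : {t | ¬ ‖f t‖ < ε / 2}.Finite := hf.eventually_lt_const (by positivity)
  refine ⟨h1.toFinset, fun P hP => lt_of_le_of_lt
    (norm_sum_u_mul_ofFun_mul_star_u_le hg hh P (half_pos hε).le fun t ht => ?_) (half_lt_self hε)⟩
  have h2 : t ∉ h1.toFinset := Finset.disjoint_left.1 hP ht
  rw [Set.Finite.mem_toFinset, Set.mem_ofPred_eq, not_not] at h2
  exact h2.le

open Classical in
theorem entry_u_mul_ofFun_mul_star_u (x : X) (g h k : G) (f : C(X, ℂ)) :
    entry x g 1 (u G X h * ofFun G X f * star (u G X k)) =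
      if g = h * k⁻¹ then f (k⁻¹ • x) else 0 := by
  rw [u_mul_ofFun_mul_star_u, entry_ofFun_mul_u, mul_one]
  split_ifs with H
  · rw [H, translateFun_apply, ← mul_smul]
    congr 2
    group
  · rfl

end CrossedProduct

/-! ### Identification of the castle sum. -/

namespace NormalizerSystem

open CrossedProduct

variable {G : Type u} {X : Type v} [Group G] [TopologicalSpace X] [CompactSpace X]
  [MulAction G X] [ContinuousConstSMul G X] {n : ℕ} (S : NormalizerSystem G X n)

theorem towerFun_ne_zero_of_phaseMul_ne_zero {i₀ : Fin n} {t : S.Shape i₀} {i j : Fin n} {x : X}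
    (hx : phaseMul (S.towerFun i₀ t) (S.phase i₀ t i * (S.phase i₀ t j)⁻¹) x ≠ 0) :
    S.towerFun i₀ t x ≠ 0 :=
  fun h => hx (phaseMul_apply_of_eq_zero _ h)

variable [T2Space X]

/-- If `e_j(x) = 0`, everything vanishes. Otherwise `x = t_j z` for a unique tower `t` and base
point `z = k x`, and no other tower contributes. -/
theorem hasSum_entry_tower (i₀ i j : Fin n) (x : X) (g : G) :
    HasSum (fun t : S.Shape i₀ => entry x g 1 (u G X (t.1 i) *
        ofFun G X (phaseMul (S.towerFun i₀ t) (S.phase i₀ t i * (S.phase i₀ t j)⁻¹)) *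
        star (u G X (t.1 j)))) (entry x g 1 (S.E i j)) := by
  classical
  simp only [entry_u_mul_ofFun_mul_star_u]
  by_cases hx : S.e j x = 0
  · have h1 : entry x g 1 (S.E i j) = 0 := by
      by_contra hne
      have h2 := S.norm_entry_right hne
      rw [one_smul, hx] at h2
      exact hne (norm_eq_zero.1 h2)
    rw [h1]
    refine hasSum_zero.congr_fun fun t => ?_
    split_ifs
    · by_contra hne
      have h2 := S.entry_ne_zero (S.towerFun_ne_zero_of_phaseMul_ne_zero hne) j
      have h3 := S.norm_entry_left h2
      rw [smul_inv_smul, hx] at h3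
      exact h2 (norm_eq_zero.1 h3)
    · rfl
  obtain ⟨k, hk⟩ := S.exists_entry_ne_zero (x := x) (h := 1) i₀ (j := j) (by rwa [one_smul])
  have hswap : entry x k 1 (S.E i₀ j) = star (entry (k • x) k⁻¹ 1 (S.E j i₀)) := by
    rw [S.entry_E_swap, entry_smul, inv_mul_cancel, one_mul]
  have hz : S.e i₀ (k • x) ≠ 0 := by
    rw [← S.norm_entry_left hk]
    exact norm_ne_zero_iff.2 hk
  obtain ⟨t, ht⟩ := S.exists_shape hz
  have htj : t.1 j = k⁻¹ := by
    by_contra hne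
    rw [hswap] at hk
    exact mul_ne_zero (S.entry_ne_zero ht j) (star_ne_zero.1 hk)
      (entry_mul_entry_eq_zero_of_column S.free (S.mem_normalizers j i₀) _ 1 hne)
  have hkt : k = (t.1 j)⁻¹ := by rw [htj, inv_inv]
  -- The relation `E_ij E_jj = E_{i i₀} E_{i₀ j}` read at `x`. With `r = f_t(z) = e_j(x)`, for `g =
  -- t_i t_j⁻¹` the right side is `(r θ_i)(r θ̄_j)`, so division by `r` leaves `θ_i θ̄_j r`.
  have hprod : entry x g 1 (S.E i j) * S.e j x =
      entry (k • x) (g * t.1 j) 1 (S.E i i₀) * star (entry (k • x) (t.1 j) 1 (S.E j i₀)) := by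
    have h1 := S.entry_E_mul_E_self x g 1 i j
    rw [one_smul] at h1
    rw [← h1, S.E_mul i j i₀ j, htj, ← hswap, entry_smul, inv_mul_cancel_right, one_mul]
    refine (hasSum_entry_mul x g 1 _ _).unique (hasSum_single k fun h hh => ?_)
    rw [(mul_eq_zero.1 (entry_mul_entry_eq_zero_of_column S.free (S.mem_normalizers i₀ j) x 1
      hh)).resolve_right hk, mul_zero]
  have hej : S.e j x = S.towerFun i₀ t (k • x) := by
    rw [← S.norm_entry_eq_towerFun ht j, S.norm_entry_left (S.entry_ne_zero ht j), htj,
      inv_smul_smul]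
  convert hasSum_single t fun t' ht' => ?_ using 1
  · split_ifs with H
    · rw [← hkt, phaseMul_apply_of_ne_zero _ ht]
      have hne : (S.towerFun i₀ t (k • x) : ℂ) ≠ 0 := Complex.ofReal_ne_zero.2 ht
      rw [H, inv_mul_cancel_right, hej] at hprod
      rw [H]
      refine mul_right_cancel₀ hne (hprod.trans ?_)
      rw [ContinuousMap.mul_apply, Circle.coe_mul, ContinuousMap.inv_apply, Circle.coe_inv_eq_conj]
      change _ = (_ / (‖entry (k • x) (t.1 i) 1 (S.E i i₀)‖ : ℂ)) *
        (starRingEnd ℂ) (_ / (‖entry (k • x) (t.1 j) 1 (S.E j i₀)‖ : ℂ)) * _ * _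
      rw [S.norm_entry_eq_towerFun ht, S.norm_entry_eq_towerFun ht, map_div₀, Complex.conj_ofReal,
        Complex.star_def]
      field_simp
    · have h1 : entry (k • x) (g * t.1 j) 1 (S.E i i₀) = 0 := by
        by_contra hne
        refine mul_ne_zero hne (S.entry_ne_zero ht i)
          (entry_mul_entry_eq_zero_of_column S.free (S.mem_normalizers i i₀) _ 1 fun h => H ?_)
        rw [← h, mul_inv_cancel_right]
      rw [h1, zero_mul] at hprod
      exact (mul_eq_zero.1 hprod).resolve_right (Complex.ofReal_ne_zero.2 hx)
  · split_ifs
    · by_contra hne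
      exact ht' (S.shape_eq_of_smul_eq (S.towerFun_ne_zero_of_phaseMul_ne_zero hne) ht
        (i := j) (j := j) (by rw [smul_inv_smul, htj, inv_smul_smul])).2.1
    · rfl

/-- The norm estimate gives some limit; amenability identifies it, since its entries agree with
those of `E_ij`. -/
theorem hasSum_tower [Countable G] (hG : IsAmenableGroup G) (i₀ i j : Fin n) :
    HasSum (fun t : S.Shape i₀ => u G X (t.1 i) *
        ofFun G X (phaseMul (S.towerFun i₀ t) (S.phase i₀ t i * (S.phase i₀ t j)⁻¹)) *
        star (u G X (t.1 j))) (S.E i j) := by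
  have hdisj : ∀ k : Fin n, ∀ t t' : S.Shape i₀, t ≠ t' → ∀ x y,
      phaseMul (S.towerFun i₀ t) (S.phase i₀ t i * (S.phase i₀ t j)⁻¹) x ≠ 0 →
      phaseMul (S.towerFun i₀ t') (S.phase i₀ t' i * (S.phase i₀ t' j)⁻¹) y ≠ 0 →
      t.1 k • x ≠ t'.1 k • y := fun k t t' htt' x y hx hy hxy =>
    htt' (S.shape_eq_of_smul_eq (S.towerFun_ne_zero_of_phaseMul_ne_zero hx)
      (S.towerFun_ne_zero_of_phaseMul_ne_zero hy) hxy).2.1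
  have hsum := summable_u_mul_ofFun_mul_star_u (hdisj i) (hdisj j)
    ((S.tendsto_norm_towerFun i₀).congr fun t => le_antisymm
      ((ContinuousMap.norm_le _ (norm_nonneg _)).2 fun x => by
        rw [← norm_phaseMul_apply _ (S.phase i₀ t i * (S.phase i₀ t j)⁻¹)]
        exact ContinuousMap.norm_coe_le_norm _ x)
      ((ContinuousMap.norm_le _ (norm_nonneg _)).2 fun x => by
        rw [norm_phaseMul_apply]
        exact ContinuousMap.norm_coe_le_norm _ x))
  obtain ⟨w, hw⟩ := hsum
  have h1 : w - S.E i j = 0 := eq_zero_of_entry_eq_zero hG fun x g => by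
    rw [map_sub, sub_eq_zero]
    exact (hw.mapL (entry x g 1)).unique (S.hasSum_entry_tower i₀ i j x g)
  rwa [← sub_eq_zero.1 h1]

end NormalizerSystem
end

/-! ### The theorem. -/

theorem mainTheorem6 {G : Type u} {X : Type v} [Group G] [Countable G]
    (hG : IsAmenableGroup G)
    [TopologicalSpace X] [CompactSpace X] [TopologicalSpace.MetrizableSpace X]
    [MulAction G X] [ContinuousConstSMul G X]
    (hfree : ∀ (g : G) (x : X), g • x = x → g = 1)
    (n : ℕ)
    (φ : CStarMatrix (Fin n) (Fin n) ℂ →ₗ[ℂ] CrossedProduct G X)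
    (hφ : IsCPCOrderZero φ)
    (hnorm : ∀ a ∈ normalizers (diagonalMatrices n), φ a ∈ normalizers (CrossedProduct.base G X)) :
    IsCastleOrderZeroMap φ := by
  rcases isEmpty_or_nonempty (Fin n) with hn | ⟨⟨i₀⟩⟩
  -- For `n = 0` there is no base index `i₀` and nothing to represent: the empty castle works.
  · exact ⟨Empty, inferInstance, Empty.elim, fun t => t.elim, fun t => t.elim, fun t => t.elim,
      fun t => t.elim, by simp [cofinite_eq_bot], ⟨fun t => t.elim, fun t => t.elim⟩,
      fun i => hn.elim i⟩
  obtain ⟨S, hS⟩ := hφ.exists_normalizerSystem hfree hnorm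
  have : Countable (S.Shape i₀) := Subtype.countable
  -- The index set must live in `Type`, whereas shapes live in the universe of `G`; countability
  -- allows the transfer along `σ`.
  have : Small.{0} (S.Shape i₀) := Countable.toSmall _
  let σ := (equivShrink.{0} (S.Shape i₀)).symm
  refine ⟨Shrink.{0} (S.Shape i₀), σ.injective.countable, fun t => S.towerFun i₀ (σ t),
    fun t => (σ t).1, fun t => S.phase i₀ (σ t), fun t => S.towerFun_nonneg i₀ _,
    fun t => S.shape_injective _, (S.tendsto_norm_towerFun i₀).comp σ.injective.tendsto_cofinite,
    ⟨fun t => (S.isCastle i₀).finite_shape _, fun t t' s hs s' hs' hne =>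
      (S.isCastle i₀).disjoint_levels _ _ s hs s' hs' fun h => hne ?_⟩, fun i j => ?_⟩
  · rw [Prod.mk.injEq] at h ⊢
    exact ⟨σ.injective h.1, h.2⟩
  · have h := S.hasSum_tower hG i₀ i j
    rw [← σ.hasSum_iff] at h
    rw [← hS]
    exact h
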